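/- Let $\pi:\mathbb{R}^3\to\mathbb{R}^2$, $(y,u,z)\mapsto(y,u)$, let $J^k(\pi)$ be the space of $k$-jets of its sections $z=f(y,u)$, with coordinates $y,u,z,z_y,z_u,z_{yy},\dots$, and let $G$ be the pseudo-group of local transformations generated by the flows of the vector fields $\partial_y,\ y\partial_y,\ z\partial_z,\ H(u)\partial_u$ ($H\in C^\infty(\mathbb{R})$), i.e. of the transformations $(y,u,z)\mapsto(ay+b,\,U(u),\,cz)$ with $a,c>0$ and $U$ an orientation-preserving local diffeomorphism of $\mathbb{R}$. For $\theta\in J^k(\pi)$ let $Z^k(\theta)\subset T_\theta J^k(\pi)$ be the span of the values at $\theta$ of the $k$-th prolongations of these vector fields. The point $\theta$ is regular if $\dim Z^k(\theta)$ is maximal, and an orbit of $G$ in $J^k(\pi)$ is regular if all its points are. A Petrov invariant of order $\le k$ is a function that is defined and smooth on an open dense subset of $J^k(\pi)$, rational in the variables $z_y,z_u,z_{yy},\dots$, and constant on the orbits of $G$. Petrov invariants $J_1,\dots,J_n$ of order $\le k$ are basic (form a local basis) in a non-empty open set $D\subset J^k(\pi)$ if they are defined in $D$, $dJ_1\wedge\dots\wedge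 dJ_n\ne0$ at every point of $D$, and in $D$ every Petrov invariant of order $\le k$ is a function of $J_1,\dots,J_n$. Let $k\ge1$ and $\nu(k)=\dfrac{k^2+k-2}{2}$. Then: 1. The number of basic Petrov invariants of order $\le k$ is $\nu(k)$: every local basis, in any non-empty open set, has exactly $\nu(k)$ elements, and the points that have a connected open neighbourhood with a local basis are dense in $J^k(\pi)$. 2. $\nu(k)$ is the codimension of a regular orbit: the points lying on regular orbits are dense in $J^k(\pi)$, every regular orbit is an embedded submanifold of $J^k(\pi)$ of codimension $\nu(k)$, and $\dim J^k(\pi)-\dim Z^k(\theta)=\nu(k)$ at every regular point $\theta$. 3. The fibres of $J^k(\pi)$ over the base $\mathbb{R}^2$ have dimension $\binom{k+2}{2}$. At every regular point $\theta$, the prolongations of those vector fields of the Lie algebra spanned by the fields above whose $(y,u)$-component vanishes at the base point of $\theta$ are tangent to the fibre, and they span a subspace of dimension $k+2$. -/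

import Mathlib

open scoped ContDiff

noncomputable section

namespace QHOE

/-- The total space of the bundle `π : (y, u, z) ↦ (y, u)`. -/
abbrev Total : Type := ℝ × ℝ × ℝ

/-- Multi-indices `(i, j)` with `i + j ≤ k`; the index `(i, j)` labels the jet coordinate
`∂^{i+j} z / ∂y^i ∂u^j`. -/
abbrev JetIdx (k : ℕ) : Type := {σ : Fin (k + 1) × Fin (k + 1) // (σ.1 : ℕ) + (σ.2 : ℕ) ≤ k}

/-- Multi-indices of order at least one (the coordinates `z_y, z_u, z_yy, …`). -/
abbrev DerivIdx (k : ℕ) : Type := {σ : JetIdx k // 1 ≤ (σ.1.1 : ℕ) + (σ.1.2 : ℕ)}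

/-- The jet space `J^k(π)` in its canonical coordinates `((y, u), (z_σ)_{|σ| ≤ k})`. -/
abbrev Jet (k : ℕ) : Type := (ℝ × ℝ) × (JetIdx k → ℝ)

/-- The projection of `J^k(π)` to the base. -/
def baseProj (k : ℕ) : Jet k →ₗ[ℝ] ℝ × ℝ := LinearMap.fst ℝ (ℝ × ℝ) (JetIdx k → ℝ)

/-- The tangent space of the fibres of `J^k(π)` over the base. -/
def vertical (k : ℕ) : Submodule ℝ (Jet k) := LinearMap.ker (baseProj k)

/-- The coordinate `z` of a jet. -/
def Jet.z {k : ℕ} (θ : Jet k) : ℝ := θ.2 ⟨(0, 0), by simp⟩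

/-- The projection `J^k(π) → J^0(π)`, `J^0(π)` being the total space. -/
def Jet.toTotal {k : ℕ} (θ : Jet k) : Total := (θ.1.1, θ.1.2, θ.z)

/-- The partial derivative `∂^{i+j} f / ∂y^i ∂u^j` at `p`. -/
def partialDeriv (i j : ℕ) (f : ℝ × ℝ → ℝ) (p : ℝ × ℝ) : ℝ :=
  iteratedDeriv i (fun s => iteratedDeriv j (fun t => f (s, t)) p.2) p.1

/-- The `k`-jet at `p` of the section `z = f(y, u)`. -/
def jetOf (k : ℕ) (f : ℝ × ℝ → ℝ) (p : ℝ × ℝ) : Jet k :=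
  (p, fun σ => partialDeriv σ.1.1 σ.1.2 f p)

/-- The Taylor polynomial with `k`-jet `θ`: a section representing `θ`. -/
def Jet.rep {k : ℕ} (θ : Jet k) (p : ℝ × ℝ) : ℝ :=
  ∑ σ : JetIdx k, θ.2 σ * (p.1 - θ.1.1) ^ (σ.1.1 : ℕ) * (p.2 - θ.1.2) ^ (σ.1.2 : ℕ) /
    ((Nat.factorial σ.1.1 : ℝ) * (Nat.factorial σ.1.2 : ℝ))

/-- The elements of the pseudo-group `G`: local transformations
`(y, u, z) ↦ (a y + b, U(u), c z)` with `a, c > 0` and `U` an orientation preserving local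
diffeomorphism of the line. These are the compositions of the local translations along
`∂/∂y`, `y ∂/∂y`, `z ∂/∂z` and `H(u) ∂/∂u`. -/
structure Feedback where
  a : ℝ
  b : ℝ
  c : ℝ
  U : OpenPartialHomeomorph ℝ ℝ
  a_pos : 0 < a
  c_pos : 0 < c
  smooth : ContDiffOn ℝ ∞ U U.source
  deriv_pos : ∀ u ∈ U.source, 0 < deriv U u

/-- The section `φ ∘ s_f ∘ φ̄⁻¹` into which `φ` carries the section `s_f` (`φ̄` is the map
induced by `φ` on the base). -/
def Feedback.mapSection (φ : Feedback) (f : ℝ × ℝ → ℝ) : ℝ × ℝ → ℝ :=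
  fun p => φ.c * f ((p.1 - φ.b) / φ.a, φ.U.symm p.2)

/-- The prolongation `φ^(k)` on `J^k(π)`: the `k`-jet of `s` at `p` goes to the `k`-jet of
`φ ∘ s ∘ φ̄⁻¹` at `φ̄ p`. It is defined at the jets `θ` with `u(θ)` in the domain of `U`. -/
def Feedback.prolong (φ : Feedback) {k : ℕ} (θ : Jet k) : Jet k :=
  jetOf k (φ.mapSection θ.rep) (φ.a * θ.1.1 + φ.b, φ.U θ.1.2)

/-- The orbit of `θ` under the prolonged pseudo-group. -/
def orbit (k : ℕ) (θ : Jet k) : Set (Jet k) :=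
  {θ' | ∃ φ : Feedback, θ.1.2 ∈ φ.U.source ∧ φ.prolong θ = θ'}

/-- The vector field `α ∂/∂y + β y ∂/∂y + γ z ∂/∂z + H(u) ∂/∂u` on the total space. -/
def feedbackField (α β γ : ℝ) (H : ℝ → ℝ) : Total → Total :=
  fun q => (α + β * q.1, H q.2.1, γ * q.2.2)

/-- The Lie algebra of vector fields of the pseudo-group. -/
def feedbackAlgebra : Set (Total → Total) :=
  {X | ∃ (α β γ : ℝ) (H : ℝ → ℝ), ContDiff ℝ ∞ H ∧ X = feedbackField α β γ H}

/-- The generating function `C - A f_y - B f_u` of the vector field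
`X = A ∂/∂y + B ∂/∂u + C ∂/∂z` along the section `z = f(y, u)`. -/
def generatingFun (X : Total → Total) (f : ℝ × ℝ → ℝ) (p : ℝ × ℝ) : ℝ :=
  (X (p.1, p.2, f p)).2.2 - (X (p.1, p.2, f p)).1 * partialDeriv 1 0 f p
    - (X (p.1, p.2, f p)).2.1 * partialDeriv 0 1 f p

/-- The value at `θ` of the prolongation `X^(k)` of `X = A ∂/∂y + B ∂/∂u + C ∂/∂z`. Its
component along `∂/∂z_σ` is `D_σ(C - A z_y - B z_u) + A z_{σ+(1,0)} + B z_{σ+(0,1)}`; the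
derivatives of order `k + 1` cancel, so that any section with `k`-jet `θ` may be used. -/
def prolongField (X : Total → Total) {k : ℕ} (θ : Jet k) : Jet k :=
  (((X θ.toTotal).1, (X θ.toTotal).2.1), fun σ =>
    partialDeriv σ.1.1 σ.1.2 (generatingFun X θ.rep) θ.1
      + (X θ.toTotal).1 * partialDeriv ((σ.1.1 : ℕ) + 1) (σ.1.2 : ℕ) θ.rep θ.1
      + (X θ.toTotal).2.1 * partialDeriv (σ.1.1 : ℕ) ((σ.1.2 : ℕ) + 1) θ.rep θ.1)

/-- The tangent subspace `Z^k(θ)` spanned by the prolonged vector fields of the algebra. -/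
def tangentSpan (k : ℕ) (θ : Jet k) : Submodule ℝ (Jet k) :=
  Submodule.span ℝ {v | ∃ X ∈ feedbackAlgebra, v = prolongField X θ}

/-- The span at `θ` of the prolongations of the stationary subalgebra of the base point of `θ`:
the fields whose component along the base vanishes there. -/
def stabilizerSpan (k : ℕ) (θ : Jet k) : Submodule ℝ (Jet k) :=
  Submodule.span ℝ {v | ∃ X ∈ feedbackAlgebra,
    (X θ.toTotal).1 = 0 ∧ (X θ.toTotal).2.1 = 0 ∧ v = prolongField X θ}

/-- `θ` is regular if `dim Z^k(θ)` is maximal. -/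
def IsRegular (k : ℕ) (θ : Jet k) : Prop :=
  ∀ θ' : Jet k, Module.finrank ℝ (tangentSpan k θ') ≤ Module.finrank ℝ (tangentSpan k θ)

/-- `O` is an orbit all of whose points are regular. -/
def IsRegularOrbit (k : ℕ) (O : Set (Jet k)) : Prop :=
  (∃ θ, O = orbit k θ) ∧ ∀ θ ∈ O, IsRegular k θ

/-- `S` is an embedded smooth submanifold of codimension `d`: locally the zero set of a
submersion to `ℝ^d`. -/
def IsSubmanifoldOfCodim {k : ℕ} (S : Set (Jet k)) (d : ℕ) : Prop :=
  ∀ θ ∈ S, ∃ W : Set (Jet k), IsOpen W ∧ θ ∈ W ∧ ∃ F : Jet k → (Fin d → ℝ),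
    ContDiffOn ℝ ∞ F W ∧ (∀ w ∈ W, Function.Surjective (fderiv ℝ F w)) ∧
      S ∩ W = {w ∈ W | F w = 0}

/-- Petrov invariants of order at most `k`: functions on an open dense subset of `J^k(π)`,
smooth there, rational in the variables `z_y, z_u, z_yy, …` (for fixed `y, u, z`), and constant
on the orbits. -/
structure PetrovInvariant (k : ℕ) where
  dom : Set (Jet k)
  toFun : Jet k → ℝ
  isOpen_dom : IsOpen dom
  dense_dom : Dense dom
  smooth : ContDiffOn ℝ ∞ toFun dom
  rational : ∃ P Q : Total → MvPolynomial (DerivIdx k) ℝ, ∀ θ ∈ dom,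
    MvPolynomial.eval (fun σ => θ.2 σ.1) (Q θ.toTotal) ≠ 0 ∧
    toFun θ = MvPolynomial.eval (fun σ => θ.2 σ.1) (P θ.toTotal) /
      MvPolynomial.eval (fun σ => θ.2 σ.1) (Q θ.toTotal)
  invariant : ∀ θ ∈ dom, ∀ θ' ∈ orbit k θ, θ' ∈ dom → toFun θ' = toFun θ

/-- `J 0, …, J (n-1)` is a local basis of the Petrov invariants of order at most `k` in `D`: they
are defined and functionally independent in `D` (`dJ_1 ∧ … ∧ dJ_n ≠ 0` at every point), and in
`D` every invariant of order at most `k` is a function of them. -/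
def IsLocalBasis {k n : ℕ} (D : Set (Jet k)) (J : Fin n → PetrovInvariant k) : Prop :=
  (∀ i, D ⊆ (J i).dom) ∧
  (∀ θ ∈ D, LinearIndependent ℝ (fun i => fderiv ℝ (J i).toFun θ)) ∧
  (∀ I : PetrovInvariant k, ∃ F : (Fin n → ℝ) → ℝ,
    ∀ θ ∈ D ∩ I.dom, I.toFun θ = F (fun i => (J i).toFun θ))

end QHOE

end

/-! Expand a section in powers of `y` about the base point: a `k`-jet becomes a list of rows
`f_i(u)`, the `i`-th `y`-derivatives, the row `f_i` being known to order `k - i`. A transformation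
replaces `f_i` by `c a⁻ⁱ f_i ∘ U⁻¹`. Rows do not mix, and the only infinite-dimensional freedom is a
common substitution in `u`. Where `z_u ≠ 0` this freedom is used up by taking `f_0` as the
coordinate: write `f_i = g_i ∘ f_0` and let `w_ij` (`Jet.normal`) be the `j`-th derivative of `g_i`
at `z`. These numbers do not see `U` and are merely rescaled, by `c^(1-j) a^(-i)`
(`Feedback.normal_prolong`). Conversely, jets with `w_ij` so related and with `z_u` of the same sign
are equivalent, the inverse function theorem supplying `U` (`mem_orbit_iff`).

Since `w_01 = 1` and `w_0j = 0` for `j ≥ 2`, there remain `(k+2 choose 2) - k` independent functions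
(`Jet.slice`), on which a two-parameter group acts by scalings. Two dimensions are lost to it, which
leaves `ν`.

Regularity of a jet means that the parameters `A, B, γ, β, H', …, H^(k)` inject into the prolonged
fields (`isRegular_iff`), so `dim Z^k = k + 4`. Injectivity forces `z_u ≠ 0` and yields two nonzero
`w_ij` with linearly independent scaling weights. Logarithms make the scaling action linear, and the
orbit is then cut out by `ν` independent equations (`isSubmanifoldOfCodim_orbit`).

For the invariants, restrict to `z z_y z_u ≠ 0`. The functions `w_ij z^(j-1) (z/z_y)^i`, apart from
those with index `(0,0)` and `(1,0)`, are `ν` rational invariants; they are independent and separate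
orbits within each sign chamber, so every invariant is a function of them (`isLocalBasis_chamber`).
Two local bases near a common point have equally many elements (`card_le_of_factors`), and every
non-empty open set meets a chamber. -/

noncomputable section

namespace QHOE

open Filter Topology

variable {k : ℕ}

/-! ### Calculus of jets of functions of one variable -/

/-- Two functions of one variable have the same `n`-jet at `x`. -/
def JetEq (n : ℕ) (x : ℝ) (f g : ℝ → ℝ) : Prop :=
  ∀ j ≤ n, iteratedDeriv j f x = iteratedDeriv j g x

theorem JetEq.refl (n : ℕ) (x : ℝ) (f : ℝ → ℝ) : JetEq n x f f := fun _ _ => rfl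

theorem JetEq.symm {n : ℕ} {x : ℝ} {f g : ℝ → ℝ} (h : JetEq n x f g) : JetEq n x g f :=
  fun j hj => (h j hj).symm

theorem JetEq.trans {n : ℕ} {x : ℝ} {f g e : ℝ → ℝ} (h : JetEq n x f g) (h' : JetEq n x g e) :
    JetEq n x f e := fun j hj => (h j hj).trans (h' j hj)

theorem JetEq.mono {m n : ℕ} {x : ℝ} {f g : ℝ → ℝ} (h : JetEq n x f g) (hmn : m ≤ n) :
    JetEq m x f g := fun j hj => h j (hj.trans hmn)

theorem contDiffAt_nat {f : ℝ → ℝ} {x : ℝ} (hf : ContDiffAt ℝ ∞ f x) (n : ℕ) :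
    ContDiffAt ℝ n f x := hf.of_le (by exact_mod_cast le_top)

theorem contDiffAt_deriv {f : ℝ → ℝ} {x : ℝ} (hf : ContDiffAt ℝ ∞ f x) :
    ContDiffAt ℝ ∞ (deriv f) x := by
  have h : ContDiffAt ℝ ∞ (fun t => fderiv ℝ f t 1) x :=
    (hf.fderiv_right (m := ∞) (by simp)).clm_apply contDiffAt_const
  exact h

theorem eventually_differentiableAt {f : ℝ → ℝ} {x : ℝ} (hf : ContDiffAt ℝ ∞ f x) :
    ∀ᶠ t in 𝓝 x, DifferentiableAt ℝ f t := by
  filter_upwards [(contDiffAt_nat hf 1).eventually (by simp)] with t ht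
  exact ht.differentiableAt (by simp)

theorem JetEq.add {n : ℕ} {x : ℝ} {f g f' g' : ℝ → ℝ} (h : JetEq n x f g) (h' : JetEq n x f' g')
    (hf : ContDiffAt ℝ ∞ f x) (hg : ContDiffAt ℝ ∞ g x) (hf' : ContDiffAt ℝ ∞ f' x)
    (hg' : ContDiffAt ℝ ∞ g' x) : JetEq n x (f + f') (g + g') := fun j hj => by
  rw [iteratedDeriv_add (contDiffAt_nat hf j) (contDiffAt_nat hf' j),
    iteratedDeriv_add (contDiffAt_nat hg j) (contDiffAt_nat hg' j), h j hj, h' j hj]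

theorem JetEq.mul {n : ℕ} {x : ℝ} {f g f' g' : ℝ → ℝ} (h : JetEq n x f g) (h' : JetEq n x f' g')
    (hf : ContDiffAt ℝ ∞ f x) (hg : ContDiffAt ℝ ∞ g x) (hf' : ContDiffAt ℝ ∞ f' x)
    (hg' : ContDiffAt ℝ ∞ g' x) : JetEq n x (f * f') (g * g') := fun j hj => by
  rw [iteratedDeriv_mul (contDiffAt_nat hf j) (contDiffAt_nat hf' j),
    iteratedDeriv_mul (contDiffAt_nat hg j) (contDiffAt_nat hg' j)]
  refine Finset.sum_congr rfl fun i hi => ?_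
  rw [Finset.mem_range] at hi
  rw [h i (by omega), h' (j - i) (by omega)]

theorem JetEq.const_mul {n : ℕ} {x : ℝ} {f g : ℝ → ℝ} (h : JetEq n x f g) (c : ℝ) :
    JetEq n x (fun t => c * f t) (fun t => c * g t) := fun j hj => by
  rw [iteratedDeriv_const_mul_field, iteratedDeriv_const_mul_field, h j hj]

theorem JetEq.pow {n : ℕ} {x : ℝ} {f g : ℝ → ℝ} (h : JetEq n x f g)
    (hf : ContDiffAt ℝ ∞ f x) (hg : ContDiffAt ℝ ∞ g x) (l : ℕ) : JetEq n x (f ^ l) (g ^ l) := by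
  induction l with
  | zero => simpa using JetEq.refl n x 1
  | succ l ih =>
    rw [pow_succ, pow_succ]
    exact ih.mul h (hf.pow l) (hg.pow l) hf hg

theorem JetEq.sum {ι : Type*} {n : ℕ} {x : ℝ} {f g : ι → ℝ → ℝ} {s : Finset ι}
    (h : ∀ i ∈ s, JetEq n x (f i) (g i)) (hf : ∀ i ∈ s, ContDiffAt ℝ ∞ (f i) x)
    (hg : ∀ i ∈ s, ContDiffAt ℝ ∞ (g i) x) :
    JetEq n x (fun t => ∑ i ∈ s, f i t) (fun t => ∑ i ∈ s, g i t) := fun j hj => by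
  rw [iteratedDeriv_fun_sum fun i hi => contDiffAt_nat (hf i hi) j,
    iteratedDeriv_fun_sum fun i hi => contDiffAt_nat (hg i hi) j]
  exact Finset.sum_congr rfl fun i hi => h i hi j hj

/-- Multiplication by a function vanishing at the point raises the order of contact. -/
theorem JetEq.mul_of_eq_zero {n : ℕ} {x : ℝ} {H f g : ℝ → ℝ} (hH0 : H x = 0)
    (h : ∀ j < n, iteratedDeriv j f x = iteratedDeriv j g x) (hH : ContDiffAt ℝ ∞ H x)
    (hf : ContDiffAt ℝ ∞ f x) (hg : ContDiffAt ℝ ∞ g x) : JetEq n x (H * f) (H * g) :=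
    fun j hj => by
  rw [iteratedDeriv_mul (contDiffAt_nat hH j) (contDiffAt_nat hf j),
    iteratedDeriv_mul (contDiffAt_nat hH j) (contDiffAt_nat hg j)]
  refine Finset.sum_congr rfl fun i hi => ?_
  rw [Finset.mem_range] at hi
  rcases Nat.eq_zero_or_pos i with rfl | hi0
  · simp [hH0]
  · rw [h (j - i) (by omega)]

theorem JetEq.deriv {n : ℕ} {x : ℝ} {f g : ℝ → ℝ} (h : JetEq n x f g) :
    ∀ j < n, iteratedDeriv j (deriv f) x = iteratedDeriv j (_root_.deriv g) x := fun j hj => by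
  rw [← iteratedDeriv_succ', ← iteratedDeriv_succ', h (j + 1) hj]

/-- Since `(h ∘ V)' = (h' ∘ V) V'` and `h'` vanishes to order one less, induction on the order works
once `h` is allowed to vary; this avoids Faà di Bruno's formula. -/
theorem iteratedDeriv_comp_eq_zero {V : ℝ → ℝ} {x : ℝ} (hV : ContDiffAt ℝ ∞ V x) (n : ℕ) :
    ∀ h : ℝ → ℝ, ContDiffAt ℝ ∞ h (V x) → (∀ j ≤ n, iteratedDeriv j h (V x) = 0) →
      ∀ j ≤ n, iteratedDeriv j (h ∘ V) x = 0 := by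
  induction n with
  | zero =>
    intro h _ h0 j hj
    obtain rfl : j = 0 := by omega
    simpa using h0 0 le_rfl
  | succ n ih =>
    intro h hh h0 j hj
    rcases j with _ | j
    · simpa using h0 0 (by omega)
    have hd : _root_.deriv (h ∘ V) =ᶠ[𝓝 x] (_root_.deriv h ∘ V) * _root_.deriv V := by
      filter_upwards [eventually_differentiableAt hV,
        hV.continuousAt.eventually (eventually_differentiableAt hh)] with t ht ht'
      exact deriv_comp t ht' ht
    have hz := ih (_root_.deriv h) (contDiffAt_deriv hh) fun i hi => by
      rw [← iteratedDeriv_succ', h0 (i + 1) (by omega)]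
    have hc : ContDiffAt ℝ ∞ (_root_.deriv h ∘ V) x := (contDiffAt_deriv hh).comp x hV
    rw [iteratedDeriv_succ', hd.iteratedDeriv_eq,
      iteratedDeriv_mul (contDiffAt_nat hc j) (contDiffAt_nat (contDiffAt_deriv hV) j)]
    refine Finset.sum_eq_zero fun i hi => ?_
    rw [Finset.mem_range] at hi
    rw [hz i (by omega)]
    simp

theorem JetEq.comp {n : ℕ} {x : ℝ} {f g V : ℝ → ℝ} (h : JetEq n (V x) f g)
    (hV : ContDiffAt ℝ ∞ V x) (hf : ContDiffAt ℝ ∞ f (V x)) (hg : ContDiffAt ℝ ∞ g (V x)) :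
    JetEq n x (f ∘ V) (g ∘ V) := fun j hj => by
  have := iteratedDeriv_comp_eq_zero hV n (f - g) (hf.sub hg) (fun i hi => by
    rw [iteratedDeriv_sub (contDiffAt_nat hf i) (contDiffAt_nat hg i), h i hi, sub_self]) j hj
  have e : (f - g) ∘ V = f ∘ V - g ∘ V := rfl
  rw [e, iteratedDeriv_sub (contDiffAt_nat (hf.comp x hV) j) (contDiffAt_nat (hg.comp x hV) j),
    sub_eq_zero] at this
  exact this

/-! ### The rows of a jet and its representing polynomial -/

/-- Derivatives at the centre of a polynomial in `t - u`. -/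
theorem iteratedDeriv_eval_sub (P : Polynomial ℝ) (u : ℝ) (j : ℕ) :
    iteratedDeriv j (fun t => P.eval (t - u)) u = (j.factorial : ℝ) * P.coeff j := by
  have key : ∀ (j : ℕ) (P : Polynomial ℝ), iteratedDeriv j (fun t => P.eval (t - u)) =
      fun t => ((Polynomial.derivative^[j]) P).eval (t - u) := by
    intro j
    induction j with
    | zero => intro P; simp
    | succ j ih =>
      intro P
      rw [iteratedDeriv_succ', Function.iterate_succ_apply, ← ih]
      congr 1
      funext t
      have h1 : HasDerivAt (fun t : ℝ => t - u) 1 t := (hasDerivAt_id t).sub_const u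
      have h2 := ((P.hasDerivAt (t - u)).comp t h1).deriv
      rw [mul_one] at h2
      exact h2
  rw [key]
  simp only [sub_self, ← Polynomial.coeff_zero_eq_eval_zero, Polynomial.coeff_iterate_derivative]
  simp [Nat.descFactorial_self]

theorem contDiff_eval_sub (P : Polynomial ℝ) (u : ℝ) :
    ContDiff ℝ ∞ (fun t => P.eval (t - u)) :=
  (P.contDiff_aeval ∞).comp (contDiff_id.sub contDiff_const)

/-- Mixed partial derivatives of sums of functions with separated variables. -/
theorem partialDeriv_sum_mul {ι : Type*} (s : Finset ι) (A B : ι → ℝ → ℝ) (p : ℝ × ℝ) (i j : ℕ)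
    (hA : ∀ r ∈ s, ContDiffAt ℝ ∞ (A r) p.1) (hB : ∀ r ∈ s, ContDiffAt ℝ ∞ (B r) p.2) :
    partialDeriv i j (fun q => ∑ r ∈ s, A r q.1 * B r q.2) p =
      ∑ r ∈ s, iteratedDeriv i (A r) p.1 * iteratedDeriv j (B r) p.2 := by
  have h1 : ∀ v : ℝ, iteratedDeriv j (fun t => ∑ r ∈ s, A r v * B r t) p.2 =
      ∑ r ∈ s, A r v * iteratedDeriv j (B r) p.2 := fun v => by
    rw [iteratedDeriv_fun_sum fun r hr => contDiffAt_const.mul (contDiffAt_nat (hB r hr) j)]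
    simp only [iteratedDeriv_const_mul_field]
  unfold partialDeriv
  simp only [h1]
  rw [iteratedDeriv_fun_sum fun r hr => (contDiffAt_nat (hA r hr) i).mul contDiffAt_const]
  simp only [iteratedDeriv_mul_const_field]

theorem partialDeriv_congr {f g : ℝ × ℝ → ℝ} {p : ℝ × ℝ} (h : f = g) (i j : ℕ) :
    partialDeriv i j f p = partialDeriv i j g p := by rw [h]

/-- The coordinate `z_{ij}` of a jet, extended by zero to all multi-indices. -/
def Jet.coord (θ : Jet k) (i j : ℕ) : ℝ :=
  if h : i + j ≤ k then θ.2 ⟨(⟨i, by omega⟩, ⟨j, by omega⟩), h⟩ else 0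

theorem Jet.coord_idx (θ : Jet k) (σ : JetIdx k) : θ.coord σ.1.1 σ.1.2 = θ.2 σ := by
  unfold Jet.coord
  rw [dif_pos σ.2]

theorem Jet.coord_of_lt (θ : Jet k) {i j : ℕ} (h : k < i + j) : θ.coord i j = 0 :=
  dif_neg (by omega)

theorem Jet.coord_zero_zero (θ : Jet k) : θ.coord 0 0 = θ.z := by
  unfold Jet.coord Jet.z
  rw [dif_pos (by omega)]
  rfl

/-- The `i`-th row `∑ⱼ z_{ij} X^j / j!` of a jet. -/
def Jet.row (θ : Jet k) (i : ℕ) : Polynomial ℝ :=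
  ∑ j ∈ Finset.range (k + 1), Polynomial.C (θ.coord i j / (j.factorial : ℝ)) * Polynomial.X ^ j

theorem Jet.coeff_row (θ : Jet k) (i j : ℕ) :
    (θ.row i).coeff j = θ.coord i j / (j.factorial : ℝ) := by
  simp only [Jet.row, Polynomial.finsetSum_coeff, Polynomial.coeff_C_mul_X_pow]
  rw [Finset.sum_ite_eq]
  split_ifs with h
  · rfl
  · rw [Finset.mem_range] at h
    rw [θ.coord_of_lt (by omega), zero_div]

/-- The `i`-th derivative in `y` of the representing polynomial, restricted to the line through
the base point. -/
def Jet.rowFun (θ : Jet k) (i : ℕ) (t : ℝ) : ℝ := (θ.row i).eval (t - θ.1.2)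

theorem Jet.contDiff_rowFun (θ : Jet k) (i : ℕ) : ContDiff ℝ ∞ (θ.rowFun i) :=
  contDiff_eval_sub _ _

theorem Jet.iteratedDeriv_rowFun (θ : Jet k) (i j : ℕ) :
    iteratedDeriv j (θ.rowFun i) θ.1.2 = θ.coord i j := by
  refine (iteratedDeriv_eval_sub (θ.row i) θ.1.2 j).trans ?_
  rw [θ.coeff_row]
  field_simp

theorem Jet.rowFun_self (θ : Jet k) (i : ℕ) : θ.rowFun i θ.1.2 = θ.coord i 0 := by
  simpa using θ.iteratedDeriv_rowFun i 0

theorem Jet.deriv_rowFun_self (θ : Jet k) (i : ℕ) : deriv (θ.rowFun i) θ.1.2 = θ.coord i 1 := by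
  simpa using θ.iteratedDeriv_rowFun i 1

theorem sum_jetIdx (g : ℕ → ℕ → ℝ) (hg : ∀ i j, k < i + j → g i j = 0) :
    ∑ σ : JetIdx k, g σ.1.1 σ.1.2 =
      ∑ i ∈ Finset.range (k + 1), ∑ j ∈ Finset.range (k + 1), g i j := by
  have h1 : ∑ σ : JetIdx k, g σ.1.1 σ.1.2 =
      ∑ σ ∈ Finset.univ.filter (fun σ : Fin (k + 1) × Fin (k + 1) => (σ.1 : ℕ) + (σ.2 : ℕ) ≤ k),
        g σ.1 σ.2 :=
    (Finset.sum_subtype _ (fun σ => by simp)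
      (fun σ : Fin (k + 1) × Fin (k + 1) => g σ.1 σ.2)).symm
  rw [h1, Finset.sum_filter_of_ne, Fintype.sum_prod_type, Finset.sum_range]
  · exact Finset.sum_congr rfl fun i _ => (Finset.sum_range (g i)).symm
  · intro σ _ hσ
    by_contra hlt
    exact hσ (hg _ _ (by omega))

/-- This separates the variables: the group and the Lie algebra act independently on the `y`-factor
and on the row, so `partialDeriv_sum_mul` reduces every prolongation to one-variable derivatives. -/
theorem Jet.rep_eq (θ : Jet k) (p : ℝ × ℝ) :
    θ.rep p = ∑ i ∈ Finset.range (k + 1),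
      ((p.1 - θ.1.1) ^ i / (i.factorial : ℝ)) * θ.rowFun i p.2 := by
  have h := sum_jetIdx (k := k) (fun i j => θ.coord i j * (p.1 - θ.1.1) ^ i * (p.2 - θ.1.2) ^ j /
    ((i.factorial : ℝ) * (j.factorial : ℝ))) (fun i j hij => by simp [θ.coord_of_lt hij])
  simp only [Jet.coord_idx] at h
  rw [Jet.rep, h]
  refine Finset.sum_congr rfl fun i _ => ?_
  simp only [Jet.rowFun, Jet.row, Polynomial.eval_finsetSum, Finset.mul_sum, Polynomial.eval_mul,
    Polynomial.eval_C, Polynomial.eval_pow, Polynomial.eval_X]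
  refine Finset.sum_congr rfl fun j _ => ?_
  field_simp

theorem contDiff_sub_pow_div (r : ℕ) (y : ℝ) :
    ContDiff ℝ ∞ (fun s : ℝ => (s - y) ^ r / (r.factorial : ℝ)) :=
  ((contDiff_id.sub contDiff_const).pow r).div_const _

theorem iteratedDeriv_sub_pow_div (r i : ℕ) (y : ℝ) :
    iteratedDeriv i (fun s : ℝ => (s - y) ^ r / (r.factorial : ℝ)) y = if i = r then 1 else 0 := by
  have h := iteratedDeriv_eval_sub
    (Polynomial.C (1 / (r.factorial : ℝ)) * Polynomial.X ^ r) y i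
  simp only [Polynomial.eval_mul, Polynomial.eval_C, Polynomial.eval_pow, Polynomial.eval_X,
    Polynomial.coeff_C_mul_X_pow] at h
  have e : (fun s : ℝ => (s - y) ^ r / (r.factorial : ℝ)) =
      fun s : ℝ => 1 / (r.factorial : ℝ) * (s - y) ^ r := by
    funext s
    ring
  rw [e, h]
  split_ifs with hi
  · subst hi
    field_simp
  · simp

theorem Jet.partialDeriv_rep (θ : Jet k) {i : ℕ} (j : ℕ) :
    partialDeriv i j θ.rep θ.1 = θ.coord i j := by
  rw [partialDeriv_congr (funext θ.rep_eq),
    partialDeriv_sum_mul (Finset.range (k + 1)) (fun r s => (s - θ.1.1) ^ r / (r.factorial : ℝ))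
      (fun r => θ.rowFun r) θ.1 i j (fun r _ => (contDiff_sub_pow_div r _).contDiffAt)
      (fun r _ => (θ.contDiff_rowFun r).contDiffAt)]
  simp only [iteratedDeriv_sub_pow_div, θ.iteratedDeriv_rowFun, ite_mul, one_mul, zero_mul]
  rw [Finset.sum_ite_eq]
  split_ifs with h
  · rfl
  · rw [Finset.mem_range] at h
    rw [θ.coord_of_lt (by omega)]

/-! ### The prolonged pseudo-group -/

theorem Feedback.hasDerivAt (φ : Feedback) {u : ℝ} (hu : u ∈ φ.U.source) :
    HasDerivAt φ.U (deriv φ.U u) u :=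
  (((φ.smooth u hu).contDiffAt (φ.U.open_source.mem_nhds hu)).differentiableAt
    (by simp)).hasDerivAt

theorem Feedback.contDiffAt_symm (φ : Feedback) {u : ℝ} (hu : u ∈ φ.U.source) :
    ContDiffAt ℝ ∞ φ.U.symm (φ.U u) := by
  refine φ.U.contDiffAt_symm_deriv (f₀' := deriv φ.U u) (φ.deriv_pos u hu).ne'
    (φ.U.map_source hu) ?_ ?_
  · rw [φ.U.left_inv hu]
    exact φ.hasDerivAt hu
  · rw [φ.U.left_inv hu]
    exact (φ.smooth u hu).contDiffAt (φ.U.open_source.mem_nhds hu)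

/-- The affine change of `y` turns `(y - y₀)^r` into `a⁻ʳ` times the same power at the new base
point, so row `i` of the image comes from row `i` alone. -/
theorem Feedback.coord_prolong (φ : Feedback) (θ : Jet k) (hu : θ.1.2 ∈ φ.U.source) {i j : ℕ}
    (hij : i + j ≤ k) :
    (φ.prolong θ).coord i j =
      φ.c * φ.a⁻¹ ^ i * iteratedDeriv j (θ.rowFun i ∘ φ.U.symm) (φ.U θ.1.2) := by
  have ha := φ.a_pos.ne'
  have hsec : φ.mapSection θ.rep = fun p => ∑ r ∈ Finset.range (k + 1),
      (φ.c * φ.a⁻¹ ^ r * ((p.1 - (φ.a * θ.1.1 + φ.b)) ^ r / (r.factorial : ℝ))) *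
        (θ.rowFun r ∘ φ.U.symm) p.2 := by
    funext p
    rw [Feedback.mapSection, θ.rep_eq, Finset.mul_sum]
    refine Finset.sum_congr rfl fun r _ => ?_
    have : (p.1 - φ.b) / φ.a - θ.1.1 = φ.a⁻¹ * (p.1 - (φ.a * θ.1.1 + φ.b)) := by
      field_simp
      ring
    simp only [this, Function.comp, mul_pow]
    ring
  unfold Jet.coord
  rw [dif_pos hij]
  simp only [Feedback.prolong, jetOf]
  rw [partialDeriv_congr hsec, partialDeriv_sum_mul (Finset.range (k + 1))
    (fun r s => φ.c * φ.a⁻¹ ^ r * ((s - (φ.a * θ.1.1 + φ.b)) ^ r / (r.factorial : ℝ)))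
    (fun r => θ.rowFun r ∘ φ.U.symm) _ i j
    (fun r _ => (contDiff_const.mul (contDiff_sub_pow_div r _)).contDiffAt)
    (fun r _ => (θ.contDiff_rowFun r).contDiffAt.comp _ (φ.contDiffAt_symm hu))]
  simp only [iteratedDeriv_const_mul_field, iteratedDeriv_sub_pow_div, mul_ite, mul_one, mul_zero,
    ite_mul, zero_mul]
  rw [Finset.sum_ite_eq, if_pos (Finset.mem_range.2 (by omega))]

/-- The rows of the transformed jet. -/
theorem Feedback.jetEq_rowFun_prolong (φ : Feedback) (θ : Jet k) (hu : θ.1.2 ∈ φ.U.source) {i : ℕ}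
    (hi : i ≤ k) :
    JetEq (k - i) (φ.U θ.1.2) ((φ.prolong θ).rowFun i)
      (fun t => φ.c * φ.a⁻¹ ^ i * (θ.rowFun i ∘ φ.U.symm) t) := fun j hj => by
  have h := (φ.prolong θ).iteratedDeriv_rowFun i j
  rw [φ.coord_prolong θ hu (by omega)] at h
  rw [iteratedDeriv_const_mul_field]
  exact h

/-! ### The prolonged vector fields -/

/-- The values at `θ` of the prolonged vector fields: `(A, B)` is the component along the base,
`γ`, `β` are the coefficients of `z ∂/∂z` and `y ∂/∂y`, and `h` holds the higher derivatives
of `H`. -/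
def fieldMap (θ : Jet k) : ((ℝ × ℝ) × (ℝ × ℝ) × (Fin k → ℝ)) →ₗ[ℝ] Jet k where
  toFun w := (w.1, fun σ => (w.2.1.1 - w.2.1.2 * (σ.1.1 : ℕ)) * θ.coord σ.1.1 σ.1.2 -
    ∑ m : Fin k, ((σ.1.2 : ℕ).choose (m + 1) : ℝ) * w.2.2 m * θ.coord σ.1.1 ((σ.1.2 : ℕ) - m))
  map_add' w w' := by
    ext σ
    · rfl
    · rfl
    · simp only [Prod.snd_add, Prod.fst_add, Pi.add_apply, mul_add, add_mul,
        Finset.sum_add_distrib]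
      ring
  map_smul' r w := by
    ext σ
    · rfl
    · rfl
    · simp only [Prod.smul_snd, Prod.smul_fst, Pi.smul_apply, smul_eq_mul, RingHom.id_apply,
        mul_sub, Finset.mul_sum]
      congr 1
      · ring
      · exact Finset.sum_congr rfl fun m _ => by ring

theorem leibniz_rowFun (θ : Jet k) {H : ℝ → ℝ} (hH : ContDiffAt ℝ ∞ H θ.1.2) (i : ℕ) {j : ℕ}
    (hj : j ≤ k) :
    iteratedDeriv j (H * deriv (θ.rowFun i)) θ.1.2 = H θ.1.2 * θ.coord i (j + 1) +
      ∑ m : Fin k, (j.choose (m + 1) : ℝ) * iteratedDeriv (m + 1) H θ.1.2 *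
        θ.coord i (j - m) := by
  rw [iteratedDeriv_mul (contDiffAt_nat hH j)
    (contDiffAt_nat (contDiffAt_deriv (θ.contDiff_rowFun i).contDiffAt) j), Finset.sum_range_succ']
  simp only [← iteratedDeriv_succ', θ.iteratedDeriv_rowFun]
  rw [add_comm]
  congr 1
  · simp
  -- The fixed range `m < k` of the parameters contains the Leibniz range `m < j`; the extra
  -- binomials vanish.
  · rw [← Finset.sum_range (fun m => (j.choose (m + 1) : ℝ) * iteratedDeriv (m + 1) H θ.1.2 *
        θ.coord i (j - m))]
    symm
    rw [← Finset.sum_subset (Finset.range_mono hj)]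
    · refine Finset.sum_congr rfl fun m hm => ?_
      rw [Finset.mem_range] at hm
      rw [show j - (m + 1) + 1 = j - m by omega]
    · intro m _ hm
      rw [Finset.mem_range] at hm
      simp [Nat.choose_eq_zero_of_lt (show j < m + 1 by omega)]

/-- Writing `y = y₀ + (y - y₀)`, the Euler part `(y - y₀) ∂_y` acts on `(y - y₀)^r` as
multiplication by `r`. The sum over a disjoint union keeps the shape of separated variables: the
first copy holds the terms in `f_r`, the second the terms in `H f_r'`. -/
theorem generatingFun_rep (θ : Jet k) (α β γ : ℝ) (H : ℝ → ℝ) :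
    generatingFun (feedbackField α β γ H) θ.rep = fun p =>
      ∑ r ∈ (Finset.range (k + 1)).disjSum (Finset.range (k + 1)),
        Sum.elim (fun (r : ℕ) (s : ℝ) =>
            (γ - β * r) * ((s - θ.1.1) ^ r / (r.factorial : ℝ)) -
              (α + β * θ.1.1) * deriv (fun s => (s - θ.1.1) ^ r / (r.factorial : ℝ)) s)
          (fun (r : ℕ) (s : ℝ) => (s - θ.1.1) ^ r / (r.factorial : ℝ)) r p.1 *
        Sum.elim (fun r => θ.rowFun r) (fun r => -(H * deriv (θ.rowFun r))) r p.2 := by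
  funext p
  have h10 : partialDeriv 1 0 θ.rep p = ∑ r ∈ Finset.range (k + 1),
      deriv (fun s => (s - θ.1.1) ^ r / (r.factorial : ℝ)) p.1 * θ.rowFun r p.2 := by
    rw [partialDeriv_congr (funext θ.rep_eq), partialDeriv_sum_mul (Finset.range (k + 1))
      (fun r s => (s - θ.1.1) ^ r / (r.factorial : ℝ)) (fun r => θ.rowFun r) p 1 0
      (fun r _ => (contDiff_sub_pow_div r _).contDiffAt)
      (fun r _ => (θ.contDiff_rowFun r).contDiffAt)]
    simp only [iteratedDeriv_one, iteratedDeriv_zero]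
  have h01 : partialDeriv 0 1 θ.rep p = ∑ r ∈ Finset.range (k + 1),
      ((p.1 - θ.1.1) ^ r / (r.factorial : ℝ)) * deriv (θ.rowFun r) p.2 := by
    rw [partialDeriv_congr (funext θ.rep_eq), partialDeriv_sum_mul (Finset.range (k + 1))
      (fun r s => (s - θ.1.1) ^ r / (r.factorial : ℝ)) (fun r => θ.rowFun r) p 0 1
      (fun r _ => (contDiff_sub_pow_div r _).contDiffAt)
      (fun r _ => (θ.contDiff_rowFun r).contDiffAt)]
    simp only [iteratedDeriv_one, iteratedDeriv_zero]
  have hE : ∀ r : ℕ, (p.1 - θ.1.1) * deriv (fun s => (s - θ.1.1) ^ r / (r.factorial : ℝ)) p.1 =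
      r * ((p.1 - θ.1.1) ^ r / (r.factorial : ℝ)) := fun r => by
    have hd : HasDerivAt (fun s : ℝ => (s - θ.1.1) ^ r / (r.factorial : ℝ))
        (r * (p.1 - θ.1.1) ^ (r - 1) * 1 / (r.factorial : ℝ)) p.1 :=
      (((hasDerivAt_id p.1).sub_const θ.1.1).pow r).div_const _
    rw [hd.deriv]
    rcases r with _ | r
    · simp
    · rw [Nat.add_sub_cancel, pow_succ]
      ring
  simp only [generatingFun, feedbackField, h10, h01, Finset.sum_disjSum, Sum.elim_inl,
    Sum.elim_inr, θ.rep_eq p, Finset.mul_sum, ← Finset.sum_sub_distrib, ← Finset.sum_add_distrib]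
  refine Finset.sum_congr rfl fun r _ => ?_
  simp only [Pi.neg_apply, Pi.mul_apply]
  linear_combination (-β * θ.rowFun r p.2) * hE r

theorem prolongField_eq (θ : Jet k) (α β γ : ℝ) {H : ℝ → ℝ} (hH : ContDiff ℝ ∞ H) :
    prolongField (feedbackField α β γ H) θ =
      fieldMap θ ((α + β * θ.1.1, H θ.1.2), (γ, β),
        fun m => iteratedDeriv (m + 1) H θ.1.2) := by
  refine Prod.ext rfl (funext fun σ => ?_)
  obtain ⟨⟨i, j⟩, hij⟩ := σ
  have hi := i.2
  have hpd : partialDeriv i j (generatingFun (feedbackField α β γ H) θ.rep) θ.1 =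
      (γ - β * (i : ℕ)) * θ.coord i j - (α + β * θ.1.1) * θ.coord (i + 1) j -
        iteratedDeriv j (H * deriv (θ.rowFun i)) θ.1.2 := by
    have hA : ∀ r : ℕ, ContDiff ℝ ∞
        (deriv (fun s => (s - θ.1.1) ^ r / (r.factorial : ℝ))) := fun r =>
      contDiff_iff_contDiffAt.2 fun s => contDiffAt_deriv (contDiff_sub_pow_div r _).contDiffAt
    have hB : ∀ r : ℕ, ContDiffAt ℝ ∞ (H * deriv (θ.rowFun r)) θ.1.2 := fun r =>
      hH.contDiffAt.mul (contDiffAt_deriv (θ.contDiff_rowFun r).contDiffAt)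
    rw [partialDeriv_congr (generatingFun_rep θ α β γ H), partialDeriv_sum_mul]
    · simp only [Finset.sum_disjSum, Sum.elim_inl, Sum.elim_inr, θ.iteratedDeriv_rowFun,
        iteratedDeriv_sub_pow_div, iteratedDeriv_neg]
      have h1 : ∀ r : ℕ, iteratedDeriv i (fun s => (γ - β * r) *
            ((s - θ.1.1) ^ r / (r.factorial : ℝ)) - (α + β * θ.1.1) *
            deriv (fun s => (s - θ.1.1) ^ r / (r.factorial : ℝ)) s) θ.1.1 =
          (γ - β * r) * (if (i : ℕ) = r then 1 else 0) -
            (α + β * θ.1.1) * (if (i : ℕ) + 1 = r then 1 else 0) := fun r => by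
        have := iteratedDeriv_sub (n := i) (x := θ.1.1)
          (f := fun s => (γ - β * r) * ((s - θ.1.1) ^ r / (r.factorial : ℝ)))
          (g := fun s => (α + β * θ.1.1) *
            deriv (fun s => (s - θ.1.1) ^ r / (r.factorial : ℝ)) s)
          (contDiffAt_nat (contDiff_const.mul (contDiff_sub_pow_div r _)).contDiffAt _)
          (contDiffAt_nat (contDiff_const.mul (hA r)).contDiffAt _)
        refine this.trans ?_
        rw [iteratedDeriv_const_mul_field, iteratedDeriv_const_mul_field, ← iteratedDeriv_succ',
          iteratedDeriv_sub_pow_div, iteratedDeriv_sub_pow_div]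
      simp only [h1]
      simp only [sub_mul, mul_ite, mul_one, mul_zero, ite_mul, zero_mul, one_mul,
        Finset.sum_sub_distrib, Finset.sum_ite_eq, Finset.mem_range, hi, if_true]
      split_ifs with h
      · ring
      · rw [θ.coord_of_lt (i := i + 1) (by omega)]
        ring
    · rintro (r | r) _
      · exact ((contDiff_const.mul (contDiff_sub_pow_div r _)).sub
          (contDiff_const.mul (hA r))).contDiffAt
      · exact (contDiff_sub_pow_div r _).contDiffAt
    · rintro (r | r) _
      · exact (θ.contDiff_rowFun r).contDiffAt
      · exact (hB r).neg
  simp only [prolongField, θ.partialDeriv_rep, hpd]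
  -- The undifferentiated `H` carries the coordinate of index `(i, j+1)`; it cancels against the
  -- last summand of the prolongation, just as the `z_{i+1,j}` terms cancel.
  rw [leibniz_rowFun θ hH.contDiffAt i (by omega : (j : ℕ) ≤ k)]
  simp only [fieldMap, feedbackField, Jet.toTotal, LinearMap.coe_mk, AddHom.coe_mk]
  ring

/-! ### Invariant derivatives with respect to the zeroth row -/

/-- The `j`-th derivative at the base point of `(f₀ - z)^l / l!`, where `f₀` is the zeroth row. -/
def Jet.bell (θ : Jet k) (j l : ℕ) : ℝ :=
  (j.factorial : ℝ) / (l.factorial : ℝ) *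
    ((θ.row 0 - Polynomial.C (θ.coord 0 0)) ^ l).coeff j

/-- Divisibility by `X` makes the matrix `bell j l` lower triangular, and the constant term of the
quotient makes its diagonal the powers of `z_u`. -/
theorem Jet.row_zero_sub (θ : Jet k) :
    ∃ q : Polynomial ℝ, θ.row 0 - Polynomial.C (θ.coord 0 0) = Polynomial.X * q ∧
      q.coeff 0 = θ.coord 0 1 := by
  refine ⟨(θ.row 0).divX, ?_, ?_⟩
  · have h := Polynomial.X_mul_divX_add (θ.row 0)
    have h0 : (θ.row 0).coeff 0 = θ.coord 0 0 := by simp [θ.coeff_row]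
    rw [h0] at h
    exact sub_eq_of_eq_add h.symm
  · rw [Polynomial.coeff_divX, θ.coeff_row]
    simp

theorem Jet.bell_of_lt (θ : Jet k) {j l : ℕ} (h : j < l) : θ.bell j l = 0 := by
  obtain ⟨q, hq, -⟩ := θ.row_zero_sub
  rw [Jet.bell, hq, mul_pow, Polynomial.coeff_X_pow_mul', if_neg (by omega), mul_zero]

theorem Jet.bell_self (θ : Jet k) (j : ℕ) : θ.bell j j = θ.coord 0 1 ^ j := by
  obtain ⟨q, hq, hq0⟩ := θ.row_zero_sub
  rw [Jet.bell, hq, mul_pow, Polynomial.coeff_X_pow_mul', if_pos le_rfl, Nat.sub_self,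
    Polynomial.coeff_zero_eq_eval_zero, Polynomial.eval_pow, ← Polynomial.coeff_zero_eq_eval_zero,
    hq0, div_self (by positivity), one_mul]

theorem Jet.iteratedDeriv_pow_rowFun (θ : Jet k) (j l : ℕ) :
    iteratedDeriv j (fun t => (θ.rowFun 0 t - θ.coord 0 0) ^ l / (l.factorial : ℝ)) θ.1.2 =
      θ.bell j l := by
  have h := iteratedDeriv_eval_sub ((θ.row 0 - Polynomial.C (θ.coord 0 0)) ^ l) θ.1.2 j
  simp only [Polynomial.eval_pow, Polynomial.eval_sub, Polynomial.eval_C] at h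
  rw [iteratedDeriv_div_const, Jet.bell]
  unfold Jet.rowFun
  rw [h]
  ring

/-- The derivatives of the rows with respect to the invariant frame: `w_{ij}` is the `j`-th
derivative at `z` of the function `g` with `f_i = g ∘ f₀`, where `f_i` is the `i`-th row. -/
def Jet.normal (θ : Jet k) (i j : ℕ) : ℝ :=
  (θ.coord i j - ∑ l : Fin j, Jet.normal θ i l * θ.bell j l) / θ.coord 0 1 ^ j
termination_by j
decreasing_by exact l.2

/-- The recursion defining `Jet.normal` is forward substitution in this triangular system; it is the
chain rule for `f_i = g_i ∘ f_0`. -/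
theorem Jet.normal_spec (θ : Jet k) (h : θ.coord 0 1 ≠ 0) (i j : ℕ) :
    ∑ l ∈ Finset.range (j + 1), θ.normal i l * θ.bell j l = θ.coord i j := by
  rw [Finset.sum_range_succ, θ.bell_self]
  conv_lhs => rw [Jet.normal.eq_def θ i j]
  rw [div_mul_cancel₀ _ (pow_ne_zero j h),
    Finset.sum_range (fun l => θ.normal i l * θ.bell j l)]
  ring

theorem Jet.eq_normal (θ : Jet k) (h : θ.coord 0 1 ≠ 0) (i n : ℕ) {w : ℕ → ℝ}
    (hw : ∀ j ≤ n, ∑ l ∈ Finset.range (j + 1), w l * θ.bell j l = θ.coord i j) :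
    ∀ j ≤ n, w j = θ.normal i j := by
  intro j
  induction j using Nat.strong_induction_on with
  | _ j ih =>
    intro hj
    have h1 := hw j hj
    have h2 := θ.normal_spec h i j
    rw [Finset.sum_range_succ] at h1 h2
    rw [Finset.sum_congr rfl fun l hl => by
      rw [ih l (Finset.mem_range.1 hl) (by have := Finset.mem_range.1 hl; omega)]] at h1
    have h3 : w j * θ.bell j j = θ.normal i j * θ.bell j j := by linarith
    rw [θ.bell_self] at h3
    exact mul_right_cancel₀ (pow_ne_zero j h) h3

theorem Jet.normal_zero (θ : Jet k) (i : ℕ) : θ.normal i 0 = θ.coord i 0 := by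
  rw [Jet.normal]
  simp

/-- The function with Taylor coefficients `w` at `z`, truncated. -/
def expand (k : ℕ) (w : ℕ → ℝ) (z v : ℝ) : ℝ :=
  ∑ l ∈ Finset.range (k + 1), w l * ((v - z) ^ l / (l.factorial : ℝ))

theorem contDiff_expand (k : ℕ) (w : ℕ → ℝ) (z : ℝ) : ContDiff ℝ ∞ (expand k w z) :=
  ContDiff.sum fun l _ => contDiff_const.mul (contDiff_sub_pow_div l z)

theorem JetEq.expand {n : ℕ} {x : ℝ} {f g : ℝ → ℝ} (h : JetEq n x f g)
    (hf : ContDiffAt ℝ ∞ f x) (hg : ContDiffAt ℝ ∞ g x) (k : ℕ) (w : ℕ → ℝ) (z : ℝ) :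
    JetEq n x (fun t => QHOE.expand k w z (f t)) (fun t => QHOE.expand k w z (g t)) := by
  have h1 : JetEq n x (f + fun _ => -z) (g + fun _ => -z) :=
    h.add (JetEq.refl _ _ _) hf hg contDiffAt_const contDiffAt_const
  have hf1 : ContDiffAt ℝ ∞ (f + fun _ => -z) x := hf.add contDiffAt_const
  have hg1 : ContDiffAt ℝ ∞ (g + fun _ => -z) x := hg.add contDiffAt_const
  have h2 := JetEq.sum (s := Finset.range (k + 1))
    (fun l _ => (h1.pow hf1 hg1 l).const_mul (w l / (l.factorial : ℝ)))
    (fun l _ => contDiffAt_const.mul (hf1.pow l)) (fun l _ => contDiffAt_const.mul (hg1.pow l))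
  convert h2 using 3 <;>
  · refine Finset.sum_congr rfl fun l _ => ?_
    simp only [Pi.pow_apply, Pi.add_apply]
    ring

theorem Jet.iteratedDeriv_expand (θ : Jet k) (w : ℕ → ℝ) {j : ℕ} (hj : j ≤ k) :
    iteratedDeriv j (fun t => expand k w (θ.coord 0 0) (θ.rowFun 0 t)) θ.1.2 =
      ∑ l ∈ Finset.range (j + 1), w l * θ.bell j l := by
  unfold expand
  rw [iteratedDeriv_fun_sum fun l _ => contDiffAt_nat (contDiff_const.mul
    (((θ.contDiff_rowFun 0).sub contDiff_const).pow l |>.div_const _)).contDiffAt j]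
  simp only [iteratedDeriv_const_mul_field, θ.iteratedDeriv_pow_rowFun]
  symm
  refine Finset.sum_subset (Finset.range_mono (by omega)) fun l _ hl => ?_
  rw [Finset.mem_range] at hl
  rw [θ.bell_of_lt (by omega), mul_zero]

theorem Jet.jetEq_normal (θ : Jet k) (h : θ.coord 0 1 ≠ 0) (i : ℕ) :
    JetEq k θ.1.2 (θ.rowFun i)
      (fun t => expand k (θ.normal i) (θ.coord 0 0) (θ.rowFun 0 t)) := fun j hj => by
  rw [θ.iteratedDeriv_rowFun, θ.iteratedDeriv_expand _ hj, θ.normal_spec h]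

theorem Jet.eq_normal_of_jetEq (θ : Jet k) (h : θ.coord 0 1 ≠ 0) {i n : ℕ} (hn : n ≤ k)
    {w : ℕ → ℝ} (hw : JetEq n θ.1.2 (θ.rowFun i)
      (fun t => expand k w (θ.coord 0 0) (θ.rowFun 0 t))) :
    ∀ j ≤ n, w j = θ.normal i j :=
  θ.eq_normal h i n fun j hj => by
    rw [← θ.iteratedDeriv_expand w (hj.trans hn), ← hw j hj, θ.iteratedDeriv_rowFun]

/-- Replacing `z` and `v` by `c z` and `c v` multiplies the `l`-th power by `c^l`; this is the
source of the weight `c^(1-l)`. -/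
theorem expand_smul (k : ℕ) {w w' : ℕ → ℝ} {c d : ℝ} (hc : c ≠ 0)
    (h : ∀ l, w' l = c * c⁻¹ ^ l * d * w l) (z v : ℝ) :
    c * d * expand k w z v = expand k w' (c * z) (c * v) := by
  unfold expand
  rw [Finset.mul_sum]
  refine Finset.sum_congr rfl fun l _ => ?_
  rw [h, ← mul_sub, mul_pow, inv_pow]
  have := pow_ne_zero l hc
  field_simp

/-! ### The action of the pseudo-group on the invariant derivatives -/

theorem Feedback.coord_prolong_zero_one (φ : Feedback) (θ : Jet k) (hu : θ.1.2 ∈ φ.U.source)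
    (hk : 1 ≤ k) :
    (φ.prolong θ).coord 0 1 = φ.c * (deriv φ.U θ.1.2)⁻¹ * θ.coord 0 1 := by
  have hd : HasDerivAt φ.U.symm (deriv φ.U θ.1.2)⁻¹ (φ.U θ.1.2) := by
    refine φ.U.hasDerivAt_symm (φ.U.map_source hu) (φ.deriv_pos _ hu).ne' ?_
    rw [φ.U.left_inv hu]
    exact φ.hasDerivAt hu
  have hf : HasDerivAt (θ.rowFun 0) (θ.coord 0 1) (φ.U.symm (φ.U θ.1.2)) := by
    rw [φ.U.left_inv hu, ← θ.deriv_rowFun_self]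
    exact (((θ.contDiff_rowFun 0).differentiable (by simp)) _).hasDerivAt
  rw [φ.coord_prolong θ hu (by omega), iteratedDeriv_one, (hf.comp _ hd).deriv]
  ring

theorem Feedback.coord_prolong_zero (φ : Feedback) (θ : Jet k) (hu : θ.1.2 ∈ φ.U.source)
    {i : ℕ} (hi : i ≤ k) :
    (φ.prolong θ).coord i 0 = φ.c * φ.a⁻¹ ^ i * θ.coord i 0 := by
  rw [φ.coord_prolong θ hu (by omega), iteratedDeriv_zero, Function.comp, φ.U.left_inv hu,
    θ.rowFun_self]

/-- Substitute `U⁻¹` in `f_i = g_i ∘ f_0`: both rows are composed with the same map, so the relation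
between them survives with only constants changed. Uniqueness of the coefficients identifies the new
`w_ij`. -/
theorem Feedback.normal_prolong (φ : Feedback) (θ : Jet k) (hu : θ.1.2 ∈ φ.U.source)
    (h : θ.coord 0 1 ≠ 0) {i j : ℕ} (hij : i + j ≤ k) (hk : 1 ≤ k) :
    (φ.prolong θ).normal i j = φ.c * φ.c⁻¹ ^ j * φ.a⁻¹ ^ i * θ.normal i j := by
  have h' : (φ.prolong θ).coord 0 1 ≠ 0 := by
    rw [φ.coord_prolong_zero_one θ hu hk]
    exact mul_ne_zero (mul_ne_zero φ.c_pos.ne' (inv_ne_zero (φ.deriv_pos _ hu).ne')) h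
  have hV := φ.contDiffAt_symm hu
  have hz : (φ.prolong θ).coord 0 0 = φ.c * θ.coord 0 0 := by
    simpa using φ.coord_prolong_zero θ hu (Nat.zero_le k)
  have hrow0 : JetEq k (φ.U θ.1.2) ((φ.prolong θ).rowFun 0)
      (fun t => φ.c * θ.rowFun 0 (φ.U.symm t)) := by
    simpa using φ.jetEq_rowFun_prolong θ hu (Nat.zero_le k)
  have hc0 : ContDiffAt ℝ ∞ (fun t => φ.c * θ.rowFun 0 (φ.U.symm t)) (φ.U θ.1.2) :=
    contDiffAt_const.mul ((θ.contDiff_rowFun 0).contDiffAt.comp _ hV)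
  -- Only `k - i` derivatives of row `i` belong to the jet; the zeros put in beyond them do not
  -- transform correctly.
  have hn : JetEq (k - i) (φ.U θ.1.2) (θ.rowFun i ∘ φ.U.symm)
      ((fun t => expand k (θ.normal i) (θ.coord 0 0) (θ.rowFun 0 t)) ∘ φ.U.symm) := by
    refine JetEq.comp ?_ hV (θ.contDiff_rowFun i).contDiffAt
      ((contDiff_expand _ _ _).comp (θ.contDiff_rowFun 0)).contDiffAt
    rw [φ.U.left_inv hu]
    exact (θ.jetEq_normal h i).mono (by omega)
  refine ((φ.prolong θ).eq_normal_of_jetEq h' (n := k - i) (by omega)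
    (w := fun l => φ.c * φ.c⁻¹ ^ l * φ.a⁻¹ ^ i * θ.normal i l) ?_ j (by omega)).symm
  refine (φ.jetEq_rowFun_prolong θ hu (by omega)).trans ((hn.const_mul _).trans ?_)
  rw [hz]
  simp only [Function.comp, expand_smul k φ.c_pos.ne' (fun l => rfl)]
  exact ((hrow0.mono (by omega)).expand ((φ.prolong θ).contDiff_rowFun 0).contDiffAt hc0 k _ _).symm

/-- Two functions with equal values and derivatives of the same sign are locally related by an
orientation preserving diffeomorphism. -/
theorem exists_local_diffeo {f g : ℝ → ℝ} {x y : ℝ} (hf : ContDiff ℝ ∞ f) (hg : ContDiff ℝ ∞ g)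
    (hxy : f x = g y) (hd : 0 < deriv f x * deriv g y) :
    ∃ U : OpenPartialHomeomorph ℝ ℝ, x ∈ U.source ∧ U x = y ∧ ContDiffOn ℝ ∞ U U.source ∧
      (∀ u ∈ U.source, 0 < deriv U u) ∧ ∀ t ∈ U.target, f (U.symm t) = g t := by
  have key : ∀ {f : ℝ → ℝ} {x : ℝ}, ContDiff ℝ ∞ f → deriv f x ≠ 0 →
      ∃ e : OpenPartialHomeomorph ℝ ℝ, x ∈ e.source ∧ (⇑e = f) ∧
        ∀ t ∈ e.source, 0 < deriv f t * deriv f x := by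
    intro f x hf hx
    have hfd : HasDerivAt f (deriv f x) x := (hf.differentiable (by simp) x).hasDerivAt
    have hcont : Continuous (deriv f) := hf.continuous_deriv (by simp)
    -- The local inverse is restricted to where the derivative keeps its sign, so that `U = g⁻¹ ∘ f`
    -- preserves orientation on its whole domain.
    have hs : IsOpen {t | 0 < deriv f t * deriv f x} :=
      isOpen_lt continuous_const (hcont.mul continuous_const)
    refine ⟨(hf.contDiffAt.toOpenPartialHomeomorph f (hfd.hasFDerivAt_equiv hx)
      (by simp)).restrOpen _ hs, ?_, ?_, ?_⟩
    · refine ⟨hf.contDiffAt.mem_toOpenPartialHomeomorph_source (hfd.hasFDerivAt_equiv hx)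
        (by simp), ?_⟩
      exact mul_self_pos.2 hx
    · rfl
    · intro t ht
      exact ht.2
  obtain ⟨e, hxe, hef, he⟩ := key hf (left_ne_zero_of_mul hd.ne')
  obtain ⟨e', hye, heg, he'⟩ := key hg (right_ne_zero_of_mul hd.ne')
  have hsrc : ∀ {t}, t ∈ (e.trans e'.symm).source → t ∈ e.source ∧ f t ∈ e'.target := by
    intro t ht
    rw [OpenPartialHomeomorph.trans_source] at ht
    refine ⟨ht.1, ?_⟩
    have := ht.2
    rw [Set.mem_preimage, hef] at this
    exact this
  have hder : ∀ t ∈ (e.trans e'.symm).source, HasDerivAt (e.trans e'.symm)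
      ((deriv g (e'.symm (f t)))⁻¹ * deriv f t) t ∧ ContDiffAt ℝ ∞ (e.trans e'.symm) t ∧
        0 < (deriv g (e'.symm (f t)))⁻¹ * deriv f t := by
    intro t ht
    obtain ⟨h1, h2⟩ := hsrc ht
    have h3 := he t h1
    have h4 := he' _ (e'.map_target h2)
    have hg0 : deriv g (e'.symm (f t)) ≠ 0 := left_ne_zero_of_mul h4.ne'
    have hgd : HasDerivAt e' (deriv g (e'.symm (f t))) (e'.symm (f t)) := by
      rw [heg]
      exact (hg.differentiable (by simp) _).hasDerivAt
    have hfd : HasDerivAt f (deriv f t) t := (hf.differentiable (by simp) _).hasDerivAt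
    have hcoe : ⇑(e.trans e'.symm) = e'.symm ∘ f := by
      rw [OpenPartialHomeomorph.coe_trans, hef]
    rw [hcoe]
    refine ⟨(e'.hasDerivAt_symm h2 hg0 hgd).comp t hfd, ?_, ?_⟩
    · refine ContDiffAt.comp t (e'.contDiffAt_symm_deriv hg0 h2 hgd ?_) hf.contDiffAt
      rw [heg]
      exact hg.contDiffAt
    · rcases lt_or_gt_of_ne hg0 with hneg | hpos
      · have : deriv g y < 0 := by nlinarith
        have : deriv f x < 0 := by nlinarith
        exact mul_pos_of_neg_of_neg (inv_lt_zero.2 hneg) (by nlinarith)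
      · have : 0 < deriv g y := by nlinarith
        have : 0 < deriv f x := by nlinarith
        exact mul_pos (inv_pos.2 hpos) (by nlinarith)
  refine ⟨e.trans e'.symm, ?_, ?_, fun t ht => (hder t ht).2.1.contDiffWithinAt, fun t ht => ?_,
    fun t ht => ?_⟩
  · rw [OpenPartialHomeomorph.trans_source]
    refine ⟨hxe, ?_⟩
    rw [Set.mem_preimage, hef, hxy, ← heg]
    exact e'.map_source hye
  · rw [OpenPartialHomeomorph.coe_trans, Function.comp, hef, hxy, ← heg]
    exact e'.left_inv hye
  · rw [(hder t ht).1.deriv]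
    exact (hder t ht).2.2
  · rw [OpenPartialHomeomorph.trans_target] at ht
    rw [OpenPartialHomeomorph.trans_symm_eq_symm_trans_symm, OpenPartialHomeomorph.coe_trans,
      OpenPartialHomeomorph.symm_symm, Function.comp, ← hef, ← heg]
    refine e.right_inv ?_
    exact ht.2

/-- Jets with proportional invariant derivatives lie on one orbit. -/
theorem mem_orbit_of_normal {θ θ' : Jet k} {a c : ℝ} (ha : 0 < a) (hc : 0 < c)
    (hs : 0 < θ.coord 0 1 * θ'.coord 0 1)
    (hn : ∀ i j, i + j ≤ k → θ'.normal i j = c * c⁻¹ ^ j * a⁻¹ ^ i * θ.normal i j) :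
    θ' ∈ orbit k θ := by
  have h := left_ne_zero_of_mul hs.ne'
  have h' := right_ne_zero_of_mul hs.ne'
  have hz : θ'.coord 0 0 = c * θ.coord 0 0 := by
    simpa [Jet.normal_zero] using hn 0 0 (by omega)
  -- `U` must carry `f_0` to `c⁻¹` times the zeroth row of `θ'`; the other rows then match because
  -- they are functions of the zeroth.
  have hg : ContDiff ℝ ∞ (fun t => c⁻¹ * θ'.rowFun 0 t) :=
    contDiff_const.mul (θ'.contDiff_rowFun 0)
  obtain ⟨U, hxU, hUx, hsm, hpos, hUf⟩ := exists_local_diffeo (x := θ.1.2) (y := θ'.1.2)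
    (θ.contDiff_rowFun 0) hg
    (by
      simp only [Jet.rowFun_self, hz]
      field_simp)
    (by
      have : deriv (fun t => c⁻¹ * θ'.rowFun 0 t) θ'.1.2 = c⁻¹ * θ'.coord 0 1 := by
        rw [← θ'.deriv_rowFun_self, ← iteratedDeriv_one, iteratedDeriv_const_mul_field,
          iteratedDeriv_one]
      rw [this, θ.deriv_rowFun_self]
      have := mul_pos (inv_pos.2 hc) hs
      linarith)
  let φ : Feedback := ⟨a, θ'.1.1 - a * θ.1.1, c, U, ha, hc, hsm, hpos⟩
  refine ⟨φ, hxU, Prod.ext (Prod.ext ?_ hUx) (funext fun σ => ?_)⟩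
  · change a * θ.1.1 + (θ'.1.1 - a * θ.1.1) = θ'.1.1
    ring
  rw [← Jet.coord_idx, ← Jet.coord_idx]
  obtain ⟨⟨⟨i, _⟩, ⟨j, _⟩⟩, hij⟩ := σ
  change i + j ≤ k at hij
  change (φ.prolong θ).coord i j = θ'.coord i j
  have hV : ContDiffAt ℝ ∞ φ.U.symm θ'.1.2 := by
    have := φ.contDiffAt_symm (u := θ.1.2) hxU
    rwa [show φ.U θ.1.2 = θ'.1.2 from hUx] at this
  have hsymm : φ.U.symm θ'.1.2 = θ.1.2 := by
    rw [← hUx]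
    exact U.left_inv hxU
  have hn1 : JetEq k θ'.1.2 (θ.rowFun i ∘ φ.U.symm)
      ((fun t => expand k (θ.normal i) (θ.coord 0 0) (θ.rowFun 0 t)) ∘ φ.U.symm) := by
    refine JetEq.comp ?_ hV (θ.contDiff_rowFun i).contDiffAt
      ((contDiff_expand _ _ _).comp (θ.contDiff_rowFun 0)).contDiffAt
    rw [hsymm]
    exact θ.jetEq_normal h i
  have hev : (fun t => φ.c * φ.a⁻¹ ^ i *
      ((fun t => expand k (θ.normal i) (θ.coord 0 0) (θ.rowFun 0 t)) ∘ φ.U.symm) t) =ᶠ[𝓝 θ'.1.2]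
      fun t => expand k (fun l => c * c⁻¹ ^ l * a⁻¹ ^ i * θ.normal i l) (θ'.coord 0 0)
        (θ'.rowFun 0 t) := by
    have hmem : U.target ∈ 𝓝 θ'.1.2 := by
      refine U.open_target.mem_nhds ?_
      rw [← hUx]
      exact U.map_source hxU
    filter_upwards [hmem] with t ht
    have h1 := hUf t ht
    simp only [Function.comp]
    change c * a⁻¹ ^ i * expand k (θ.normal i) (θ.coord 0 0) (θ.rowFun 0 (U.symm t)) = _
    rw [expand_smul k hc.ne' (fun l => rfl), h1, hz, mul_inv_cancel_left₀ hc.ne']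
  rw [φ.coord_prolong θ hxU hij, show φ.U θ.1.2 = θ'.1.2 from hUx, hn1 j (by omega),
    ← iteratedDeriv_const_mul_field, hev.iteratedDeriv_eq, θ'.iteratedDeriv_expand _ (by omega),
    ← θ'.normal_spec h']
  refine Finset.sum_congr rfl fun l hl => ?_
  rw [Finset.mem_range] at hl
  rw [hn i l (by omega)]

theorem mem_orbit_iff {θ θ' : Jet k} (hk : 1 ≤ k) (h : θ.coord 0 1 ≠ 0) :
    θ' ∈ orbit k θ ↔ 0 < θ.coord 0 1 * θ'.coord 0 1 ∧ ∃ a c : ℝ, 0 < a ∧ 0 < c ∧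
      ∀ i j, i + j ≤ k → θ'.normal i j = c * c⁻¹ ^ j * a⁻¹ ^ i * θ.normal i j := by
  constructor
  · rintro ⟨φ, hu, rfl⟩
    refine ⟨?_, φ.a, φ.c, φ.a_pos, φ.c_pos, fun i j hij => φ.normal_prolong θ hu h hij hk⟩
    rw [φ.coord_prolong_zero_one θ hu hk]
    have h1 := mul_pos φ.c_pos (inv_pos.2 (φ.deriv_pos _ hu))
    have h2 := mul_self_pos.2 h
    have := mul_pos h1 h2
    linarith
  · rintro ⟨hs, a, c, ha, hc, hn⟩
    exact mem_orbit_of_normal ha hc hs hn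

/-! ### Smoothness -/

theorem contDiff_coord (i j : ℕ) : ContDiff ℝ ∞ (fun θ : Jet k => θ.coord i j) := by
  unfold Jet.coord
  split_ifs with h
  · exact (contDiff_apply ℝ ℝ _).comp contDiff_snd
  · exact contDiff_const

theorem coeff_row_zero_sub (θ : Jet k) (j : ℕ) :
    (θ.row 0 - Polynomial.C (θ.coord 0 0)).coeff j =
      if j = 0 then 0 else θ.coord 0 j / (j.factorial : ℝ) := by
  rw [Polynomial.coeff_sub, θ.coeff_row, Polynomial.coeff_C]
  split_ifs with h
  · subst h
    simp
  · simp

theorem contDiff_coeff_pow (l : ℕ) : ∀ j : ℕ, ContDiff ℝ ∞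
    (fun θ : Jet k => ((θ.row 0 - Polynomial.C (θ.coord 0 0)) ^ l).coeff j) := by
  induction l with
  | zero =>
    intro j
    simp only [pow_zero]
    exact contDiff_const
  | succ l ih =>
    intro j
    simp only [pow_succ, Polynomial.coeff_mul]
    refine ContDiff.sum fun p _ => (ih p.1).mul ?_
    simp only [coeff_row_zero_sub]
    split_ifs with h
    · exact contDiff_const
    · exact (contDiff_coord 0 p.2).div_const _

theorem contDiff_bell (j l : ℕ) : ContDiff ℝ ∞ (fun θ : Jet k => θ.bell j l) :=
  contDiff_const.mul (contDiff_coeff_pow l j)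

/-- The recursion divides only by powers of `z_u`; rationality of the `w_ij` follows in the same
way. -/
theorem contDiffAt_normal {θ : Jet k} (h : θ.coord 0 1 ≠ 0) (i j : ℕ) :
    ContDiffAt ℝ ∞ (fun θ : Jet k => θ.normal i j) θ := by
  induction j using Nat.strong_induction_on with
  | _ j ih =>
    have e : (fun θ : Jet k => θ.normal i j) = fun θ : Jet k =>
        (θ.coord i j - ∑ l : Fin j, θ.normal i l * θ.bell j l) / θ.coord 0 1 ^ j := by
      funext θ
      rw [Jet.normal]
    rw [e]
    exact ((contDiff_coord i j).contDiffAt.sub (ContDiffAt.sum fun (l : Fin j) _ =>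
      (ih l l.2).mul (contDiff_bell j l).contDiffAt)).div
      ((contDiff_coord 0 1).contDiffAt.pow j) (pow_ne_zero j h)

/-! ### Rationality -/

/-- Functions on a set of jets that are rational in the variables `z_y, z_u, z_yy, …`. -/
def RationalOn (s : Set (Jet k)) (f : Jet k → ℝ) : Prop :=
  ∃ P Q : Total → MvPolynomial (DerivIdx k) ℝ, ∀ θ ∈ s,
    MvPolynomial.eval (fun σ => θ.2 σ.1) (Q θ.toTotal) ≠ 0 ∧
    f θ = MvPolynomial.eval (fun σ => θ.2 σ.1) (P θ.toTotal) /
      MvPolynomial.eval (fun σ => θ.2 σ.1) (Q θ.toTotal)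

theorem RationalOn.const (s : Set (Jet k)) (c : ℝ) : RationalOn s (fun _ => c) :=
  ⟨fun _ => MvPolynomial.C c, fun _ => 1, fun _ _ => by simp⟩

theorem RationalOn.add {s : Set (Jet k)} {f g : Jet k → ℝ} (hf : RationalOn s f)
    (hg : RationalOn s g) : RationalOn s (fun θ => f θ + g θ) := by
  obtain ⟨P, Q, h⟩ := hf
  obtain ⟨P', Q', h'⟩ := hg
  refine ⟨fun q => P q * Q' q + Q q * P' q, fun q => Q q * Q' q, fun θ hθ => ?_⟩
  obtain ⟨h1, h2⟩ := h θ hθ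
  obtain ⟨h3, h4⟩ := h' θ hθ
  simp only [map_mul, map_add]
  exact ⟨mul_ne_zero h1 h3, by rw [h2, h4, div_add_div _ _ h1 h3]⟩

theorem RationalOn.mul {s : Set (Jet k)} {f g : Jet k → ℝ} (hf : RationalOn s f)
    (hg : RationalOn s g) : RationalOn s (fun θ => f θ * g θ) := by
  obtain ⟨P, Q, h⟩ := hf
  obtain ⟨P', Q', h'⟩ := hg
  refine ⟨fun q => P q * P' q, fun q => Q q * Q' q, fun θ hθ => ?_⟩
  obtain ⟨h1, h2⟩ := h θ hθ
  obtain ⟨h3, h4⟩ := h' θ hθ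
  simp only [map_mul]
  exact ⟨mul_ne_zero h1 h3, by rw [h2, h4, div_mul_div_comm]⟩

theorem RationalOn.inv {s : Set (Jet k)} {f : Jet k → ℝ} (hf : RationalOn s f)
    (h0 : ∀ θ ∈ s, f θ ≠ 0) : RationalOn s (fun θ => (f θ)⁻¹) := by
  obtain ⟨P, Q, h⟩ := hf
  refine ⟨Q, P, fun θ hθ => ?_⟩
  obtain ⟨h1, h2⟩ := h θ hθ
  have h3 := h0 θ hθ
  rw [h2] at h3
  exact ⟨(div_ne_zero_iff.1 h3).1, by simp only [h2, inv_div]⟩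

theorem RationalOn.pow {s : Set (Jet k)} {f : Jet k → ℝ} (hf : RationalOn s f) (n : ℕ) :
    RationalOn s (fun θ => f θ ^ n) := by
  induction n with
  | zero => simpa using RationalOn.const s 1
  | succ n ih => simpa only [pow_succ] using ih.mul hf

theorem RationalOn.sum {ι : Type*} {s : Set (Jet k)} {f : ι → Jet k → ℝ} (t : Finset ι)
    (hf : ∀ i ∈ t, RationalOn s (f i)) : RationalOn s (fun θ => ∑ i ∈ t, f i θ) := by
  classical
  induction t using Finset.induction_on with
  | empty => simpa using RationalOn.const s 0
  | insert i t hi ih =>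
    simp only [Finset.sum_insert hi]
    exact (hf i (by simp)).add (ih fun j hj => hf j (by simp [hj]))

theorem RationalOn.coord (s : Set (Jet k)) (i j : ℕ) : RationalOn s (fun θ => θ.coord i j) := by
  by_cases h : i + j ≤ k
  · rcases Nat.eq_zero_or_pos (i + j) with h0 | h0
    · obtain ⟨rfl, rfl⟩ : i = 0 ∧ j = 0 := by omega
      refine ⟨fun q => MvPolynomial.C q.2.2, fun _ => 1, fun θ _ => ?_⟩
      simp [Jet.coord_zero_zero, Jet.toTotal]
    · refine ⟨fun _ => MvPolynomial.X ⟨⟨(⟨i, by omega⟩, ⟨j, by omega⟩), h⟩, h0⟩, fun _ => 1,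
        fun θ _ => ?_⟩
      simp [Jet.coord, h]
  · simpa [Jet.coord, h] using RationalOn.const s 0

theorem RationalOn.coeff_pow (s : Set (Jet k)) (l : ℕ) : ∀ j : ℕ, RationalOn s
    (fun θ : Jet k => ((θ.row 0 - Polynomial.C (θ.coord 0 0)) ^ l).coeff j) := by
  induction l with
  | zero =>
    intro j
    simp only [pow_zero]
    exact RationalOn.const s _
  | succ l ih =>
    intro j
    simp only [pow_succ, Polynomial.coeff_mul]
    refine RationalOn.sum _ fun p _ => (ih p.1).mul ?_
    simp only [coeff_row_zero_sub]
    split_ifs with h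
    · exact RationalOn.const s _
    · simp only [div_eq_mul_inv]
      exact (RationalOn.coord s 0 p.2).mul (RationalOn.const s _)

theorem RationalOn.normal {s : Set (Jet k)} (h : ∀ θ ∈ s, θ.coord 0 1 ≠ 0) (i j : ℕ) :
    RationalOn s (fun θ => θ.normal i j) := by
  induction j using Nat.strong_induction_on with
  | _ j ih =>
    have e : (fun θ : Jet k => θ.normal i j) = fun θ : Jet k =>
        (θ.coord i j + (-1) * ∑ l : Fin j, θ.normal i l * θ.bell j l) *
          (θ.coord 0 1 ^ j)⁻¹ := by
      funext θ
      rw [Jet.normal]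
      ring
    rw [e]
    refine ((RationalOn.coord s i j).add ((RationalOn.const s _).mul (RationalOn.sum _ fun (l : Fin j) _ =>
      (ih l l.2).mul ((RationalOn.const s _).mul (RationalOn.coeff_pow s l j))))).mul
      (((RationalOn.coord s 0 1).pow j).inv fun θ hθ => pow_ne_zero j (h θ hθ))

/-! ### The invariant derivatives as coordinates -/

/-- The indices of `z` and of the derivatives of positive order in `y`. -/
abbrev NormalIdx (k : ℕ) : Type := {σ : JetIdx k // (σ.1.1 : ℕ) = 0 → (σ.1.2 : ℕ) = 0}

/-- The invariant derivatives `w_{ij}` that move along the slice. -/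
def Jet.slice (θ : Jet k) : NormalIdx k → ℝ := fun s => θ.normal s.1.1.1 s.1.1.2

/-- The index `(i, j)`. -/
def NormalIdx.mk (i j : ℕ) (h : i + j ≤ k) (h0 : i = 0 → j = 0) : NormalIdx k :=
  ⟨⟨(⟨i, by omega⟩, ⟨j, by omega⟩), h⟩, h0⟩

theorem Jet.slice_mk (θ : Jet k) {i j : ℕ} (h : i + j ≤ k) (h0 : i = 0 → j = 0) :
    θ.slice (NormalIdx.mk i j h h0) = θ.normal i j := rfl

theorem NormalIdx.exists_mk (s : NormalIdx k) :
    ∃ (i j : ℕ) (h : i + j ≤ k) (h0 : i = 0 → j = 0), s = NormalIdx.mk i j h h0 :=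
  ⟨s.1.1.1, s.1.1.2, s.1.2, s.2, rfl⟩

theorem contDiffAt_slice {θ : Jet k} (h : θ.coord 0 1 ≠ 0) :
    ContDiffAt ℝ ∞ (Jet.slice : Jet k → NormalIdx k → ℝ) θ :=
  contDiffAt_pi.2 fun _ => contDiffAt_normal h _ _

theorem Jet.bell_congr {θ θ' : Jet k} (h : ∀ m, 1 ≤ m → θ.coord 0 m = θ'.coord 0 m) (j l : ℕ) :
    θ.bell j l = θ'.bell j l := by
  have e : θ.row 0 - Polynomial.C (θ.coord 0 0) = θ'.row 0 - Polynomial.C (θ'.coord 0 0) := by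
    ext m
    rw [coeff_row_zero_sub, coeff_row_zero_sub]
    split_ifs with hm
    · rfl
    · rw [h m (by omega)]
  rw [Jet.bell, Jet.bell, e]

/-- The jet with invariant derivatives `ξ` and the remaining coordinates of `θ`. -/
def Jet.ofSlice (θ : Jet k) (ξ : NormalIdx k → ℝ) : Jet k :=
  (θ.1, fun σ => if h : (σ.1.1 : ℕ) = 0 then
      if h' : (σ.1.2 : ℕ) = 0 then ξ ⟨σ, fun _ => h'⟩ else θ.2 σ
    else ∑ l : Fin ((σ.1.2 : ℕ) + 1),
      ξ (NormalIdx.mk σ.1.1 l (by have := σ.2; omega) (fun h0 => absurd h0 h)) *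
        θ.bell σ.1.2 l)

theorem contDiff_ofSlice (θ : Jet k) : ContDiff ℝ ∞ θ.ofSlice := by
  refine contDiff_const.prodMk (contDiff_pi.2 fun σ => ?_)
  split_ifs with h h'
  · exact contDiff_apply ℝ ℝ _
  · exact contDiff_const
  · exact ContDiff.sum fun l _ => (contDiff_apply ℝ ℝ _).mul contDiff_const

theorem Jet.coord_ofSlice_zero (θ : Jet k) (ξ : NormalIdx k → ℝ) {m : ℕ} (hm : 1 ≤ m) :
    (θ.ofSlice ξ).coord 0 m = θ.coord 0 m := by
  unfold Jet.coord
  split_ifs with h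
  · simp [Jet.ofSlice, show m ≠ 0 by omega]
  · rfl

/-- The matrix `bell` depends only on `z_0m` with `m ≥ 1`, which `Jet.ofSlice` leaves alone, so the
prescribed values solve the triangular system of the new jet. -/
theorem Jet.slice_ofSlice (θ : Jet k) (h : θ.coord 0 1 ≠ 0) (ξ : NormalIdx k → ℝ) :
    (θ.ofSlice ξ).slice = ξ := by
  funext s
  obtain ⟨i, j, hij, h0, rfl⟩ := s.exists_mk
  rw [Jet.slice_mk]
  rcases Nat.eq_zero_or_pos i with rfl | hi
  · obtain rfl := h0 rfl
    rw [Jet.normal_zero, Jet.coord, dif_pos hij]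
    simp only [Jet.ofSlice]
    rfl
  · have h' : (θ.ofSlice ξ).coord 0 1 ≠ 0 := by rwa [θ.coord_ofSlice_zero ξ le_rfl]
    let w : ℕ → ℝ := fun l => if hl : i + l ≤ k then
      ξ (NormalIdx.mk i l hl (fun h0 => absurd h0 hi.ne')) else 0
    have hw := (θ.ofSlice ξ).eq_normal h' i j (w := w) (fun m hm => ?_) j le_rfl
    · rw [← hw]
      simp only [w]
      rw [dif_pos hij]
    · rw [Finset.sum_range]
      conv_rhs => rw [Jet.coord, dif_pos (show i + m ≤ k by omega)]
      simp only [Jet.ofSlice]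
      rw [dif_neg hi.ne']
      refine Finset.sum_congr rfl fun l _ => ?_
      have hl := l.2
      simp only [w]
      rw [dif_pos (by omega)]
      congr 1
      exact Jet.bell_congr (fun m hm => θ.coord_ofSlice_zero ξ hm) m l

theorem Jet.ofSlice_slice (θ : Jet k) (h : θ.coord 0 1 ≠ 0) : θ.ofSlice θ.slice = θ := by
  refine Prod.ext rfl (funext fun σ => ?_)
  simp only [Jet.ofSlice]
  split_ifs with h1 h2
  · change θ.normal σ.1.1 σ.1.2 = _
    rw [h2, Jet.normal_zero, ← h2, θ.coord_idx]
  · rfl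
  · rw [← θ.coord_idx, ← θ.normal_spec h, Finset.sum_range]
    rfl

/-- `Jet.ofSlice θ` is a smooth right inverse of `Jet.slice` passing through `θ`, so the chain rule
gives a right inverse of the differential. -/
theorem surjective_fderiv_slice {θ : Jet k} (h : θ.coord 0 1 ≠ 0) :
    Function.Surjective (fderiv ℝ (Jet.slice : Jet k → NormalIdx k → ℝ) θ) := by
  have h1 : HasFDerivAt θ.ofSlice (fderiv ℝ θ.ofSlice θ.slice) θ.slice :=
    ((contDiff_ofSlice θ).differentiable (by simp) _).hasFDerivAt
  have h2 : HasFDerivAt (Jet.slice : Jet k → NormalIdx k → ℝ)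
      (fderiv ℝ (Jet.slice : Jet k → NormalIdx k → ℝ) θ) (θ.ofSlice θ.slice) := by
    rw [θ.ofSlice_slice h]
    exact ((contDiffAt_slice h).differentiableAt (by simp)).hasFDerivAt
  have h3 := h2.comp θ.slice h1
  have e : (Jet.slice : Jet k → NormalIdx k → ℝ) ∘ θ.ofSlice = id :=
    funext fun ξ => θ.slice_ofSlice h ξ
  rw [e] at h3
  have h4 := h3.unique (hasFDerivAt_id θ.slice)
  intro v
  exact ⟨fderiv ℝ θ.ofSlice θ.slice v, congrArg (fun L => L v) h4⟩

/-! ### Dimensions -/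

theorem card_jetIdx (k : ℕ) : Fintype.card (JetIdx k) = (k + 2).choose 2 := by
  have h := sum_jetIdx (k := k) (fun i j => if i + j ≤ k then 1 else 0)
    (fun i j hij => if_neg (by omega))
  have h1 : ∑ σ : JetIdx k, (if (σ.1.1 : ℕ) + (σ.1.2 : ℕ) ≤ k then (1 : ℝ) else 0) =
      Fintype.card (JetIdx k) := by
    rw [Finset.sum_congr rfl fun σ _ => if_pos σ.2]
    simp
  have h2 : ∀ i ∈ Finset.range (k + 1),
      ∑ j ∈ Finset.range (k + 1), (if i + j ≤ k then (1 : ℝ) else 0) = ((k + 1 - i : ℕ) : ℝ) := by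
    intro i hi
    rw [Finset.mem_range] at hi
    rw [← Finset.sum_filter, Finset.sum_const, nsmul_eq_mul, mul_one]
    congr 1
    rw [show (Finset.range (k + 1)).filter (fun j => i + j ≤ k) = Finset.range (k + 1 - i) by
      ext j
      simp only [Finset.mem_filter, Finset.mem_range]
      omega, Finset.card_range]
  rw [h1, Finset.sum_congr rfl h2, ← Nat.cast_sum] at h
  have h3 : Fintype.card (JetIdx k) = ∑ i ∈ Finset.range (k + 1), (k + 1 - i) := by exact_mod_cast h
  have h4 := Finset.sum_range_reflect (fun i => i) (k + 2)
  rw [Finset.sum_range_succ, Finset.sum_range_id] at h4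
  have h5 : ∑ i ∈ Finset.range (k + 1), (k + 1 - i) =
      ∑ i ∈ Finset.range (k + 1), (k + 2 - 1 - i) := rfl
  rw [h3, Nat.choose_two_right, h5]
  omega

theorem card_normalIdx (k : ℕ) : Fintype.card (NormalIdx k) + k = (k + 2).choose 2 := by
  have h := Fintype.card_subtype_compl
    (fun σ : JetIdx k => (σ.1.1 : ℕ) = 0 → (σ.1.2 : ℕ) = 0)
  have hle := Fintype.card_subtype_le (fun σ : JetIdx k => (σ.1.1 : ℕ) = 0 → (σ.1.2 : ℕ) = 0)
  -- The excluded indices are `(0, j)` with `1 ≤ j ≤ k`; `w_01, …, w_0k` are constants.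
  have e : {σ : JetIdx k // ¬((σ.1.1 : ℕ) = 0 → (σ.1.2 : ℕ) = 0)} ≃ Fin k :=
    { toFun := fun σ => ⟨(σ.1.1.2 : ℕ) - 1, by
        have h1 := σ.2
        have h2 := σ.1.2
        push Not at h1
        omega⟩
      invFun := fun m => ⟨⟨(⟨0, by omega⟩, ⟨m + 1, by omega⟩), by simp⟩, by simp⟩
      left_inv := fun σ => by
        have h1 := σ.2
        push Not at h1
        refine Subtype.ext (Subtype.ext (Prod.ext (Fin.ext h1.1.symm) (Fin.ext ?_)))
        change (σ.1.1.2 : ℕ) - 1 + 1 = σ.1.1.2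
        omega
      right_inv := fun m => by
        ext
        simp }
  rw [Fintype.card_congr e, Fintype.card_fin, card_jetIdx] at h
  rw [card_jetIdx] at hle
  change Fintype.card (NormalIdx k) ≤ _ at hle
  change k = _ - Fintype.card (NormalIdx k) at h
  omega

theorem finrank_jet (k : ℕ) : Module.finrank ℝ (Jet k) = (k + 2).choose 2 + 2 := by
  rw [Module.finrank_prod, Module.finrank_prod, Module.finrank_self,
    Module.finrank_fintype_fun_eq_card, card_jetIdx]
  omega

theorem finrank_vertical (k : ℕ) : Module.finrank ℝ (vertical k) = (k + 2).choose 2 := by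
  have h := (baseProj k).finrank_range_add_finrank_ker
  have hr : (baseProj k).range = ⊤ := LinearMap.range_eq_top.2 Prod.fst_surjective
  rw [hr, finrank_top, finrank_jet, Module.finrank_prod, Module.finrank_self] at h
  change _ + Module.finrank ℝ (vertical k) = _ at h
  omega

/-! ### Regular jets -/

theorem exists_contDiff_iteratedDeriv (d : ℕ → ℝ) (u : ℝ) (n : ℕ) :
    ∃ H : ℝ → ℝ, ContDiff ℝ ∞ H ∧ ∀ j ≤ n, iteratedDeriv j H u = d j := by
  refine ⟨fun t => (∑ j ∈ Finset.range (n + 1), Polynomial.C (d j / (j.factorial : ℝ)) *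
    Polynomial.X ^ j).eval (t - u), contDiff_eval_sub _ _, fun j hj => ?_⟩
  rw [iteratedDeriv_eval_sub]
  simp only [Polynomial.finsetSum_coeff, Polynomial.coeff_C_mul_X_pow]
  rw [Finset.sum_ite_eq, if_pos (Finset.mem_range.2 (by omega))]
  field_simp

/-- A polynomial `H` realises any prescribed derivatives at `u`, and `α = A - β y₀` realises `A`, so
the parameters in `fieldMap` are really free. -/
theorem exists_prolongField_eq (θ : Jet k) (w : (ℝ × ℝ) × (ℝ × ℝ) × (Fin k → ℝ)) :
    ∃ X ∈ feedbackAlgebra, ((X θ.toTotal).1, (X θ.toTotal).2.1) = w.1 ∧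
      prolongField X θ = fieldMap θ w := by
  obtain ⟨H, hH, hd⟩ := exists_contDiff_iteratedDeriv
    (fun j => if h : 1 ≤ j ∧ j ≤ k then w.2.2 ⟨j - 1, by omega⟩ else w.1.2) θ.1.2 k
  have h0 : H θ.1.2 = w.1.2 := by simpa using hd 0 (Nat.zero_le k)
  have e : ((w.1.1 - w.2.1.2 * θ.1.1 + w.2.1.2 * θ.1.1, H θ.1.2), (w.2.1.1, w.2.1.2),
      fun m : Fin k => iteratedDeriv (m + 1) H θ.1.2) = w := by
    refine Prod.ext (Prod.ext (by simp) h0) (Prod.ext rfl (funext fun m => ?_))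
    have hm := m.2
    refine (hd _ (by omega : (m : ℕ) + 1 ≤ k)).trans ?_
    rw [dif_pos ⟨by omega, by omega⟩]
    rfl
  refine ⟨feedbackField (w.1.1 - w.2.1.2 * θ.1.1) w.2.1.2 w.2.1.1 H, ⟨_, _, _, H, hH, rfl⟩, ?_, ?_⟩
  · exact congrArg Prod.fst e
  · rw [prolongField_eq θ _ _ _ hH, e]

theorem tangentSpan_eq (θ : Jet k) : tangentSpan k θ = (fieldMap θ).range := by
  refine le_antisymm (Submodule.span_le.2 ?_) ?_
  · rintro v ⟨X, ⟨α, β, γ, H, hH, rfl⟩, rfl⟩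
    rw [prolongField_eq θ _ _ _ hH]
    exact LinearMap.mem_range_self _ _
  · rintro v ⟨w, rfl⟩
    obtain ⟨X, hX, -, h⟩ := exists_prolongField_eq θ w
    exact Submodule.subset_span ⟨X, hX, h.symm⟩

theorem stabilizerSpan_eq (θ : Jet k) : stabilizerSpan k θ =
    ((fieldMap θ).comp (LinearMap.inr ℝ (ℝ × ℝ) ((ℝ × ℝ) × (Fin k → ℝ)))).range := by
  refine le_antisymm (Submodule.span_le.2 ?_) ?_
  · rintro v ⟨X, ⟨α, β, γ, H, hH, rfl⟩, h1, h2, rfl⟩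
    rw [prolongField_eq θ _ _ _ hH]
    refine ⟨((γ, β), fun m => iteratedDeriv (m + 1) H θ.1.2), ?_⟩
    rw [LinearMap.comp_apply, LinearMap.inr_apply]
    congr 1
    exact Prod.ext (Prod.ext h1.symm h2.symm) rfl
  · rintro v ⟨w, rfl⟩
    obtain ⟨X, hX, h1, h⟩ := exists_prolongField_eq θ (0, w)
    exact Submodule.subset_span
      ⟨X, hX, congrArg Prod.fst h1, congrArg Prod.snd h1, h.symm⟩

theorem stabilizerSpan_le_vertical (θ : Jet k) : stabilizerSpan k θ ≤ vertical k := by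
  rw [stabilizerSpan_eq]
  rintro v ⟨w, rfl⟩
  rfl

theorem finrank_fieldMap_domain (k : ℕ) :
    Module.finrank ℝ ((ℝ × ℝ) × (ℝ × ℝ) × (Fin k → ℝ)) = k + 4 := by
  simp only [Module.finrank_prod, Module.finrank_self, Module.finrank_fintype_fun_eq_card,
    Fintype.card_fin]
  omega

theorem fieldMap_eq_zero_iff (θ : Jet k) (w : (ℝ × ℝ) × (ℝ × ℝ) × (Fin k → ℝ)) :
    fieldMap θ w = 0 ↔ w.1 = 0 ∧ ∀ i j, i + j ≤ k →
      (w.2.1.1 - w.2.1.2 * i) * θ.coord i j =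
        ∑ m : Fin k, (j.choose (m + 1) : ℝ) * w.2.2 m * θ.coord i (j - m) := by
  constructor
  · intro h
    refine ⟨congrArg Prod.fst h, fun i j hij => ?_⟩
    have := congrFun (congrArg Prod.snd h) ⟨(⟨i, by omega⟩, ⟨j, by omega⟩), hij⟩
    exact sub_eq_zero.1 this
  · rintro ⟨h1, h2⟩
    exact Prod.ext h1 (funext fun σ => sub_eq_zero.2 (h2 _ _ σ.2))

/-- The condition `z z_y z_u ≠ 0`. -/
def Jet.Generic (θ : Jet k) : Prop :=
  θ.coord 0 0 ≠ 0 ∧ θ.coord 1 0 ≠ 0 ∧ θ.coord 0 1 ≠ 0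

/-- The components `(0,0)` and `(1,0)` of a vanishing field give `γ = 0` and `β = 0`. Component `(0,
n+1)` then gives the vanishing of `H^(n+1)`, whose coefficient there is `z_u`, once the lower
derivatives vanish. -/
theorem Jet.Generic.injective {θ : Jet k} (hθ : θ.Generic) (hk : 1 ≤ k) :
    Function.Injective (fieldMap θ) := by
  refine (injective_iff_map_eq_zero _).2 fun w hw => ?_
  obtain ⟨h1, h2⟩ := (fieldMap_eq_zero_iff θ w).1 hw
  have hγ : w.2.1.1 = 0 := by
    have := h2 0 0 (by omega)
    simpa [hθ.1] using this
  have hβ : w.2.1.2 = 0 := by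
    have := h2 1 0 (by omega)
    simpa [hθ.2.1, hγ] using this
  have hh : ∀ n (hn : n < k), w.2.2 ⟨n, hn⟩ = 0 := by
    intro n
    induction n using Nat.strong_induction_on with
    | _ n ih =>
      intro hn
      have h3 := h2 0 (n + 1) (by omega)
      rw [Finset.sum_eq_single ⟨n, hn⟩] at h3
      · simpa [hγ, hβ, hθ.2.2] using h3.symm
      · intro m _ hm
        have hm' : (m : ℕ) ≠ n := fun h => hm (Fin.ext h)
        rcases lt_or_gt_of_ne hm' with h | h
        · rw [ih m h m.2]
          ring
        · rw [Nat.choose_eq_zero_of_lt (by omega)]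
          simp
      · simp
  exact Prod.ext h1 (Prod.ext (Prod.ext hγ hβ) (funext fun m => hh m m.2))

theorem exists_generic (hk : 1 ≤ k) : ∃ θ : Jet k, θ.Generic :=
  ⟨(0, fun _ => 1), by
    refine ⟨?_, ?_, ?_⟩ <;>
    · rw [Jet.coord, dif_pos (by omega)]
      exact one_ne_zero⟩

/-- The rank is at most the number `k + 4` of parameters, and a generic jet attains it. -/
theorem isRegular_iff (hk : 1 ≤ k) (θ : Jet k) :
    IsRegular k θ ↔ Function.Injective (fieldMap θ) := by
  have hle : ∀ θ : Jet k, Module.finrank ℝ (tangentSpan k θ) +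
      Module.finrank ℝ (fieldMap θ).ker = k + 4 := fun θ => by
    rw [tangentSpan_eq, LinearMap.finrank_range_add_finrank_ker, finrank_fieldMap_domain]
  constructor
  · intro h
    obtain ⟨θ₀, h₀⟩ := exists_generic hk
    have h1 := hle θ₀
    rw [LinearMap.ker_eq_bot.2 (h₀.injective hk), finrank_bot] at h1
    have h2 := h θ₀
    have h3 := hle θ
    refine LinearMap.ker_eq_bot.1 (Submodule.finrank_eq_zero.1 (by omega))
  · intro h θ'
    have h1 := hle θ
    rw [LinearMap.ker_eq_bot.2 h, finrank_bot] at h1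
    have := hle θ'
    omega

theorem finrank_tangentSpan {θ : Jet k} (h : Function.Injective (fieldMap θ)) :
    Module.finrank ℝ (tangentSpan k θ) = k + 4 := by
  rw [tangentSpan_eq, LinearMap.finrank_range_of_inj h, finrank_fieldMap_domain]

theorem finrank_stabilizerSpan {θ : Jet k} (h : Function.Injective (fieldMap θ)) :
    Module.finrank ℝ (stabilizerSpan k θ) = k + 2 := by
  have hi : Function.Injective
      ((fieldMap θ).comp (LinearMap.inr ℝ (ℝ × ℝ) ((ℝ × ℝ) × (Fin k → ℝ)))) :=
    h.comp LinearMap.inr_injective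
  rw [stabilizerSpan_eq, LinearMap.finrank_range_of_inj hi]
  simp only [Module.finrank_prod, Module.finrank_self, Module.finrank_fintype_fun_eq_card,
    Fintype.card_fin]
  omega

/-- A field whose only nonzero parameter is `H^(k)` affects only the coordinate `(0, k)`, with
coefficient `z_u` up to sign; if `z_u = 0` it lies in the kernel. -/
theorem coord_zero_one_ne_zero (hk : 1 ≤ k) {θ : Jet k} (h : Function.Injective (fieldMap θ)) :
    θ.coord 0 1 ≠ 0 := by
  intro h0
  have hw : fieldMap θ (0, 0, Pi.single ⟨k - 1, by omega⟩ 1) = 0 := by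
    refine (fieldMap_eq_zero_iff θ _).2 ⟨rfl, fun i j hij => ?_⟩
    symm
    simp only [Prod.fst_zero, Prod.snd_zero, zero_mul, sub_zero]
    refine Finset.sum_eq_zero fun m _ => ?_
    by_cases hm : m = ⟨k - 1, by omega⟩
    · subst hm
      change (j.choose (k - 1 + 1) : ℝ) * _ * θ.coord i (j - (k - 1)) = 0
      rcases Nat.lt_or_ge j k with hj | hj
      · rw [Nat.choose_eq_zero_of_lt (by omega)]
        simp
      · obtain rfl : j = k := by omega
        obtain rfl : i = 0 := by omega
        rw [show j - (j - 1) = 1 by omega, h0, mul_zero]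
    · rw [Pi.single_eq_of_ne hm]
      ring
  have := h (hw.trans (map_zero (fieldMap θ)).symm)
  have h2 := congrFun (congrArg (fun w => w.2.2) this) ⟨k - 1, by omega⟩
  simp at h2

/-- For `i = 0` the function `g_0` is the identity. -/
theorem Jet.normal_zero_left (hk : 1 ≤ k) (θ : Jet k) (h : θ.coord 0 1 ≠ 0) {l : ℕ} (hl : l ≤ k)
    (hl1 : 1 ≤ l) : θ.normal 0 l = if l = 1 then 1 else 0 := by
  let w : ℕ → ℝ := fun l => if l = 0 then θ.coord 0 0 else if l = 1 then 1 else 0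
  have he : ∀ v, expand k w (θ.coord 0 0) v = v := by
    intro v
    obtain ⟨n, rfl⟩ : ∃ n, k = n + 1 := ⟨k - 1, by omega⟩
    rw [expand, Finset.sum_range_succ', Finset.sum_range_succ', Finset.sum_eq_zero]
    · simp [w]
    · intro l _
      simp [w]
  have := θ.eq_normal_of_jetEq h (i := 0) (n := k) le_rfl (w := w)
    (by simpa only [he] using JetEq.refl _ _ _) l hl
  rw [← this]
  simp [w, show l ≠ 0 by omega]

theorem hasDerivAt_expand (k : ℕ) (w : ℕ → ℝ) (z v : ℝ) :
    ∃ d, HasDerivAt (expand k w z) d v ∧ (v - z) * d = expand k (fun l => l * w l) z v := by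
  refine ⟨∑ l ∈ Finset.range (k + 1), w l * (l * (v - z) ^ (l - 1) * 1 / (l.factorial : ℝ)),
    HasDerivAt.fun_sum fun l _ =>
      ((((hasDerivAt_id v).sub_const z).pow l).div_const _).const_mul _, ?_⟩
  rw [expand, Finset.mul_sum]
  refine Finset.sum_congr rfl fun l _ => ?_
  rcases l with _ | l
  · simp
  · rw [Nat.add_sub_cancel, pow_succ]
    ring

/-- At a regular jet no nonzero infinitesimal scaling fixes the invariant derivatives. -/
theorem scaling_eq_zero (hk : 1 ≤ k) {θ : Jet k} (hinj : Function.Injective (fieldMap θ))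
    {γ β : ℝ} (hγβ : ∀ i j, i + j ≤ k → (i = 0 → j = 0) →
      θ.normal i j * (γ - β * i - γ * j) = 0) : γ = 0 ∧ β = 0 := by
  have h01 := coord_zero_one_ne_zero hk hinj
  -- Chosen so that `H f_0' = γ (f_0 - z)`. Then `H ∂_u` acts on `f_i = g_i ∘ f_0` as `γ (v - z)
  -- d/dv` on `g_i`, multiplying `w_il` by `γ l`, and all components of the field are controlled by
  -- the scaling weights.
  let H : ℝ → ℝ := fun t => γ * (θ.rowFun 0 t - θ.coord 0 0) / deriv (θ.rowFun 0) t
  have hd0 : ContDiff ℝ ∞ (deriv (θ.rowFun 0)) :=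
    contDiff_iff_contDiffAt.2 fun t => contDiffAt_deriv (θ.contDiff_rowFun 0).contDiffAt
  have hd1 : deriv (θ.rowFun 0) θ.1.2 ≠ 0 := by rwa [θ.deriv_rowFun_self]
  have hH : ContDiffAt ℝ ∞ H θ.1.2 :=
    (contDiff_const.mul ((θ.contDiff_rowFun 0).sub contDiff_const)).contDiffAt.div
      hd0.contDiffAt hd1
  have hH0 : H θ.1.2 = 0 := by simp [H, θ.rowFun_self]
  have hw : fieldMap θ (0, (γ, β), fun m => iteratedDeriv (m + 1) H θ.1.2) = 0 := by
    refine (fieldMap_eq_zero_iff θ _).2 ⟨rfl, fun i j hij => ?_⟩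
    have hL := leibniz_rowFun θ hH i (show j ≤ k by omega)
    rw [hH0, zero_mul, zero_add] at hL
    refine Eq.trans ?_ hL
    have hG : ContDiff ℝ ∞
        (fun t => expand k (θ.normal i) (θ.coord 0 0) (θ.rowFun 0 t)) :=
      (contDiff_expand _ _ _).comp (θ.contDiff_rowFun 0)
    have h1 := JetEq.mul_of_eq_zero hH0 (θ.jetEq_normal h01 i).deriv hH
      (contDiffAt_deriv (θ.contDiff_rowFun i).contDiffAt) (contDiffAt_deriv hG.contDiffAt)
    have hev : H * deriv (fun t => expand k (θ.normal i) (θ.coord 0 0) (θ.rowFun 0 t))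
        =ᶠ[𝓝 θ.1.2] fun t => γ * expand k (fun l => l * θ.normal i l) (θ.coord 0 0)
          (θ.rowFun 0 t) := by
      filter_upwards [hd0.continuous.continuousAt.eventually_ne hd1] with t ht
      obtain ⟨d, hd, hdz⟩ := hasDerivAt_expand k (θ.normal i) (θ.coord 0 0) (θ.rowFun 0 t)
      have hc := hd.comp t ((θ.contDiff_rowFun 0).differentiable (by simp) t).hasDerivAt
      have hc' : deriv (fun t => expand k (θ.normal i) (θ.coord 0 0) (θ.rowFun 0 t)) t =
        d * deriv (θ.rowFun 0) t := hc.deriv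
      simp only [Pi.mul_apply, H]
      rw [hc', ← hdz]
      field_simp
    rw [h1 j (by omega), hev.iteratedDeriv_eq, iteratedDeriv_const_mul_field,
      θ.iteratedDeriv_expand _ (by omega), ← θ.normal_spec h01, Finset.mul_sum, Finset.mul_sum]
    refine Finset.sum_congr rfl fun l hl => ?_
    rw [Finset.mem_range] at hl
    suffices h : θ.normal i l * (γ - β * i - γ * l) = 0 by
      linear_combination θ.bell j l * h
    by_cases hil : i = 0 → l = 0
    · exact hγβ i l (by omega) hil
    · push Not at hil
      obtain ⟨rfl, hl0⟩ := hil
      rw [θ.normal_zero_left hk h01 (by omega) (by omega)]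
      split_ifs with hl1
      · subst hl1
        simp
      · simp
  have := hinj (hw.trans (map_zero (fieldMap θ)).symm)
  have h2 : (γ, β) = (0 : ℝ × ℝ) := congrArg (fun w => w.2.1) this
  exact ⟨congrArg Prod.fst h2, congrArg Prod.snd h2⟩

/-! ### Linear algebra of differentials -/

/-- On directions where the coordinates `s` and `t` do not change, the covectors `G r` are nonzero
multiples of distinct coordinates, so their values can be prescribed freely. This serves both for
the orbit equations and for the basis of invariants. -/
theorem exists_forall_apply_eq {ι N E : Type*} [DecidableEq N] [AddCommGroup E] [Module ℝ E]
    {X : E → N → ℝ} (hX : Function.Surjective X) {e : ι → N} (he : Function.Injective e) {s t : N}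
    (hs : ∀ r, e r ≠ s) (ht : ∀ r, e r ≠ t) {G : ι → E → ℝ} {m : ι → ℝ} (hm : ∀ r, m r ≠ 0)
    (hG : ∀ r v, X v s = 0 → X v t = 0 → G r v = m r * X v (e r)) (y : ι → ℝ) :
    ∃ v, ∀ r, G r v = y r := by
  obtain ⟨v, hv⟩ := hX (Function.extend e (fun r => (m r)⁻¹ * y r) 0)
  have h0 : ∀ q, (∀ r, e r ≠ q) → X v q = 0 := fun q hq => by
    rw [hv, Function.extend_apply' _ _ _ (by rintro ⟨r, hr⟩; exact hq r hr)]
    rfl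
  refine ⟨v, fun r => ?_⟩
  rw [hG r v (h0 s hs) (h0 t ht), hv, he.extend_apply, mul_inv_cancel_left₀ (hm r)]

theorem linearIndependent_of_surjective {n : ℕ} {E : Type*} [NormedAddCommGroup E]
    [NormedSpace ℝ E] {L : Fin n → E →L[ℝ] ℝ} (h : ∀ y : Fin n → ℝ, ∃ v, ∀ r, L r v = y r) :
    LinearIndependent ℝ L := by
  rw [Fintype.linearIndependent_iff]
  intro g hg i
  obtain ⟨v, hv⟩ := h (Pi.single i 1)
  have := congrArg (fun M : E →L[ℝ] ℝ => M v) hg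
  simpa [hv, Pi.single_apply] using this

/-- A nonzero functional vanishing on the range would be a nontrivial linear relation among the `L
i`. -/
theorem surjective_of_linearIndependent {n : ℕ} {E : Type*} [NormedAddCommGroup E]
    [NormedSpace ℝ E] {L : Fin n → E →L[ℝ] ℝ} (h : LinearIndependent ℝ L) :
    (ContinuousLinearMap.pi L).range = ⊤ := by
  by_contra hne
  obtain ⟨f, hf, hle⟩ := Submodule.exists_le_ker_of_lt_top _ (lt_top_iff_ne_top.2 hne)
  refine hf (LinearMap.pi_ext' fun i => LinearMap.ext_ring ?_)
  refine Fintype.linearIndependent_iff.1 h (fun i => f (Pi.single i 1)) ?_ i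
  ext v
  have h1 : f (fun i => L i v) = 0 := hle ⟨v, rfl⟩
  rw [LinearMap.pi_apply_eq_sum_univ] at h1
  rw [zero_apply, sum_apply, ← h1]
  refine Finset.sum_congr rfl fun i _ => ?_
  rw [smul_apply, smul_eq_mul, smul_eq_mul, mul_comm]
  congr 2
  funext j
  simp [Pi.single_apply, eq_comm]

/-- The differential of a function of `f` vanishes on the kernel of the differential of a
submersion `f`. -/
theorem fderiv_eq_zero_of_factors {n : ℕ} {E : Type*} [NormedAddCommGroup E] [NormedSpace ℝ E]
    [FiniteDimensional ℝ E] {f : E → Fin n → ℝ} {f' : E →L[ℝ] Fin n → ℝ} {x : E}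
    (hf : HasStrictFDerivAt f f' x) (hf' : f'.range = ⊤) {K : E → ℝ} {K' : E →L[ℝ] ℝ}
    (hK : HasFDerivAt K K' x) {F : (Fin n → ℝ) → ℝ} (hF : ∀ᶠ t in 𝓝 x, K t = F (f t))
    {v : E} (hv : f' v = 0) : K' v = 0 := by
  have : CompleteSpace E := FiniteDimensional.complete ℝ E
  set g := hf.implicitFunction f f' hf' (f x) with hg
  have hg' : HasStrictFDerivAt g f'.ker.subtypeL 0 := hf.to_implicitFunction hf'
  have hg0 : g 0 = x := hf.implicitFunction_apply_image hf'
  have hfg : ∀ᶠ y in 𝓝 (0 : f'.ker), f (g y) = f x := by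
    have h := hf.map_implicitFunction_eq hf'
    have hc : Tendsto (fun y : f'.ker => (f x, y)) (𝓝 0) (𝓝 (f x, 0)) :=
      (Continuous.prodMk continuous_const continuous_id).tendsto' _ _ rfl
    exact hc.eventually h
  -- No regularity of `F` is available, so the chain rule cannot be applied to it. Instead, `K` is
  -- constant along the fibre of `f`, which the implicit function parametrises.
  have hKg : (fun y => K (g y)) =ᶠ[𝓝 0] fun _ => F (f x) := by
    have hgc : Tendsto g (𝓝 0) (𝓝 x) := by
      have := hg'.hasFDerivAt.continuousAt.tendsto
      rwa [hg0] at this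
    filter_upwards [hfg, hgc.eventually hF] with y h1 h2
    rw [h2, h1]
  have h1 : HasFDerivAt (fun y => K (g y)) (K'.comp f'.ker.subtypeL) 0 := by
    refine HasFDerivAt.comp (0 : f'.ker) ?_ hg'.hasFDerivAt
    rwa [hg0]
  have h2 := h1.unique ((hasFDerivAt_const (F (f x)) (0 : f'.ker)).congr_of_eventuallyEq hKg)
  exact congrArg (fun L : f'.ker →L[ℝ] ℝ => L ⟨v, hv⟩) h2

/-- If independent functions `K` are functions of independent functions `J`, there are at most as
many of them. -/
theorem card_le_of_factors {n m : ℕ} {E : Type*} [NormedAddCommGroup E] [NormedSpace ℝ E]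
    [FiniteDimensional ℝ E] {J : Fin n → E → ℝ} {K : Fin m → E → ℝ} {x : E}
    (hJ : ∀ i, ContDiffAt ℝ ∞ (J i) x) (hK : ∀ i, ContDiffAt ℝ ∞ (K i) x)
    (hJi : LinearIndependent ℝ fun i => fderiv ℝ (J i) x)
    (hKi : LinearIndependent ℝ fun i => fderiv ℝ (K i) x)
    (hF : ∀ i, ∃ F : (Fin n → ℝ) → ℝ, ∀ᶠ t in 𝓝 x, K i t = F fun j => J j t) : m ≤ n := by
  have hJs : HasStrictFDerivAt (fun t j => J j t)
      (ContinuousLinearMap.pi fun i => fderiv ℝ (J i) x) x :=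
    hasStrictFDerivAt_pi.2 fun i => (hJ i).hasStrictFDerivAt (by simp)
  have h1 := surjective_of_linearIndependent hJi
  have h2 := surjective_of_linearIndependent hKi
  have hle : (ContinuousLinearMap.pi fun i => fderiv ℝ (J i) x).ker ≤
      (ContinuousLinearMap.pi fun i => fderiv ℝ (K i) x).ker := by
    intro v hv
    refine LinearMap.mem_ker.2 (funext fun i => ?_)
    obtain ⟨F, hFi⟩ := hF i
    exact fderiv_eq_zero_of_factors hJs h1 ((hK i).differentiableAt (by simp)).hasFDerivAt hFi hv
  have h3 := Submodule.finrank_mono hle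
  have h4 := LinearMap.finrank_range_add_finrank_ker
    (ContinuousLinearMap.pi fun i => fderiv ℝ (J i) x).toLinearMap
  have h5 := LinearMap.finrank_range_add_finrank_ker
    (ContinuousLinearMap.pi fun i => fderiv ℝ (K i) x).toLinearMap
  rw [h1, finrank_top, Module.finrank_fin_fun] at h4
  rw [h2, finrank_top, Module.finrank_fin_fun] at h5
  omega

/-! ### Orbits in the slice coordinates -/

/-- The omitted `w_0j` are constant on `z_u ≠ 0`: `w_01 = 1` has weight `c c⁻¹ = 1` and the others
vanish, so they impose no condition. -/
theorem mem_orbit_iff_slice {θ θ' : Jet k} (hk : 1 ≤ k) (h : θ.coord 0 1 ≠ 0) :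
    θ' ∈ orbit k θ ↔ 0 < θ.coord 0 1 * θ'.coord 0 1 ∧ ∃ a c : ℝ, 0 < a ∧ 0 < c ∧
      ∀ s : NormalIdx k, θ'.slice s =
        c * c⁻¹ ^ (s.1.1.2 : ℕ) * a⁻¹ ^ (s.1.1.1 : ℕ) * θ.slice s := by
  rw [mem_orbit_iff hk h]
  refine and_congr_right fun hs => exists_congr fun a => exists_congr fun c =>
    and_congr_right fun ha => and_congr_right fun hc => ?_
  constructor
  · intro hn s
    exact hn _ _ s.1.2
  · intro hn i j hij
    by_cases h0 : i = 0 → j = 0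
    · exact hn (NormalIdx.mk i j hij h0)
    · push Not at h0
      obtain ⟨rfl, hj⟩ := h0
      rw [θ.normal_zero_left hk h (by omega) (by omega),
        θ'.normal_zero_left hk (right_ne_zero_of_mul hs.ne') (by omega) (by omega)]
      split_ifs with h1
      · subst h1
        field_simp
      · simp

theorem exp_weight (A C : ℝ) (i j : ℕ) :
    Real.exp C * (Real.exp C)⁻¹ ^ j * (Real.exp A)⁻¹ ^ i = Real.exp ((1 - j) * C - i * A) := by
  rw [← Real.exp_neg, ← Real.exp_neg, ← Real.exp_nat_mul, ← Real.exp_nat_mul, ← Real.exp_add,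
    ← Real.exp_add]
  congr 1
  ring

/-- The scaling weight of an invariant derivative with respect to `z ∂/∂z`. -/
def NormalIdx.weight (s : NormalIdx k) : ℝ := 1 - (s.1.1.2 : ℕ)

/-- The order in `y` of an invariant derivative. -/
def NormalIdx.order (s : NormalIdx k) : ℝ := (s.1.1.1 : ℕ)

theorem exists_independent_weights (hk : 1 ≤ k) {θ : Jet k}
    (hinj : Function.Injective (fieldMap θ)) :
    ∃ s t : NormalIdx k, θ.slice s ≠ 0 ∧ θ.slice t ≠ 0 ∧
      s.weight * t.order - s.order * t.weight ≠ 0 := by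
  have key : ∀ γ β : ℝ, (γ ≠ 0 ∨ β ≠ 0) →
      ∃ s : NormalIdx k, θ.slice s ≠ 0 ∧ γ * s.weight - β * s.order ≠ 0 := by
    intro γ β hne
    by_contra! hall
    have := scaling_eq_zero hk hinj (γ := γ) (β := β) fun i j hij h0 => by
      by_cases hx : θ.normal i j = 0
      · rw [hx, zero_mul]
      · have h1 : γ * (1 - (j : ℝ)) - β * (i : ℝ) = 0 := hall (NormalIdx.mk i j hij h0) hx
        rw [show γ - β * i - γ * j = γ * (1 - (j : ℝ)) - β * (i : ℝ) by ring, h1, mul_zero]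
    rcases hne with h | h
    · exact h this.1
    · exact h this.2
  -- The pair `(1, 1)` only ensures that `(weight, order)` of `s` is nonzero. This vector, with its
  -- entries exchanged, is then the test pair, so the condition on `t` is the nonvanishing of the
  -- determinant.
  obtain ⟨s, hs, hs'⟩ := key 1 1 (Or.inl one_ne_zero)
  obtain ⟨t, ht, ht'⟩ := key s.order s.weight (by
    by_contra! h
    exact hs' (by rw [h.1, h.2]; ring))
  exact ⟨s, t, hs, ht, fun h => ht' (by linarith)⟩

theorem exists_index_equiv {ν : ℕ} (hν : ν + k + 2 = (k + 2).choose 2) {s t : NormalIdx k}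
    (hst : s ≠ t) : Nonempty (Fin ν ≃ {q : NormalIdx k // q ≠ s ∧ q ≠ t}) := by
  have h1 : Fintype.card {q : NormalIdx k // q ≠ s ∧ q ≠ t} = ν := by
    have h2 := card_normalIdx k
    have h3 : (Finset.univ.filter fun q : NormalIdx k => q ≠ s ∧ q ≠ t) =
        (Finset.univ.erase s).erase t := by
      ext q
      simp [and_comm]
    rw [Fintype.card_subtype, h3, Finset.card_erase_of_mem (by simp [hst.symm]),
      Finset.card_erase_of_mem (by simp), Finset.card_univ]
    omega
  exact ⟨(Fintype.equivFinOfCardEq h1).symm⟩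

theorem hasFDerivAt_slice_apply {θ : Jet k} (h : θ.coord 0 1 ≠ 0) (s : NormalIdx k) :
    HasFDerivAt (fun θ : Jet k => θ.slice s) ((ContinuousLinearMap.proj s).comp
      (fderiv ℝ (Jet.slice : Jet k → NormalIdx k → ℝ) θ)) θ :=
  hasFDerivAt_pi'.1 ((contDiffAt_slice h).differentiableAt (by simp)).hasFDerivAt s

/-- The set of jets whose invariant derivatives have the same signs as those of `θ`, where these
do not vanish. -/
def signSet (θ : Jet k) : Set (Jet k) :=
  {θ' | 0 < θ.coord 0 1 * θ'.coord 0 1} ∩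
    Jet.slice ⁻¹' {ξ | ∀ s, θ.slice s ≠ 0 → 0 < θ.slice s * ξ s}

theorem isOpen_signSet (θ : Jet k) : IsOpen (signSet θ) := by
  refine ContinuousOn.isOpen_inter_preimage (fun θ' hθ' => ?_) ?_ ?_
  · exact (contDiffAt_slice (right_ne_zero_of_mul (ne_of_gt hθ'))).continuousAt.continuousWithinAt
  · exact isOpen_lt continuous_const (continuous_const.mul (contDiff_coord 0 1).continuous)
  · rw [Set.ofPred_forall]
    refine isOpen_iInter_of_finite fun s => ?_
    by_cases h : θ.slice s = 0
    · simp [h]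
    · simp only [ne_eq, h, not_false_eq_true, forall_const]
      exact isOpen_lt continuous_const (continuous_const.mul (continuous_apply s))

/-- On the set of prescribed signs the orbit is given by `w_q = 0` where `w_q(θ) = 0` and by
log-ratios `L q` that depend linearly on `(log c, log a)` elsewhere. The values at `s` and `t`
determine `(log c, log a)`, so each of the other `ν` indices contributes one equation. -/
theorem isSubmanifoldOfCodim_orbit (hk : 1 ≤ k) {ν : ℕ} (hν : ν + k + 2 = (k + 2).choose 2)
    {θ : Jet k} (hinj : Function.Injective (fieldMap θ)) :
    IsSubmanifoldOfCodim (orbit k θ) ν := by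
  have h01 := coord_zero_one_ne_zero hk hinj
  obtain ⟨s, t, hs, ht, hst⟩ := exists_independent_weights hk hinj
  have hne : s ≠ t := by
    rintro rfl
    exact hst (by ring)
  obtain ⟨e⟩ := exists_index_equiv hν hne
  -- `Real.log` sees only absolute values; the signs are fixed by `signSet`.
  let L : NormalIdx k → Jet k → ℝ := fun q θ' => Real.log (θ'.slice q) - Real.log (θ.slice q)
  -- Cramer's rule: the weight vector of `q` in the basis given by `s` and `t`.
  have hPQ : ∀ q : NormalIdx k, ∃ p r : ℝ, q.weight = p * s.weight + r * t.weight ∧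
      q.order = p * s.order + r * t.order := fun q =>
    ⟨(q.weight * t.order - q.order * t.weight) / (s.weight * t.order - s.order * t.weight),
      (s.weight * q.order - s.order * q.weight) / (s.weight * t.order - s.order * t.weight), by
        rw [div_mul_eq_mul_div, div_mul_eq_mul_div, ← add_div, eq_div_iff hst]
        ring, by
        rw [div_mul_eq_mul_div, div_mul_eq_mul_div, ← add_div, eq_div_iff hst]
        ring⟩
  choose P Q hPw hPo using hPQ
  let F : Jet k → Fin ν → ℝ := fun θ' r => if θ.slice (e r).1 = 0 then θ'.slice (e r).1
    else L (e r).1 θ' - P (e r).1 * L s θ' - Q (e r).1 * L t θ'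
  have hW0 : ∀ {θ' : Jet k}, θ' ∈ signSet θ → ∀ {q}, θ.slice q ≠ 0 → θ'.slice q ≠ 0 :=
    fun hθ' q hq => right_ne_zero_of_mul (hθ'.2 q hq).ne'
  have hW1 : ∀ {θ' : Jet k}, θ' ∈ signSet θ → θ'.coord 0 1 ≠ 0 :=
    fun hθ' => right_ne_zero_of_mul (ne_of_gt hθ'.1)
  have hLexp : ∀ {θ' : Jet k}, θ' ∈ signSet θ → ∀ {q}, θ.slice q ≠ 0 →
      θ'.slice q = Real.exp (L q θ') * θ.slice q := by
    intro θ' hθ' q hq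
    have hpos : 0 < θ'.slice q / θ.slice q := by
      have : θ'.slice q / θ.slice q = θ.slice q * θ'.slice q / (θ.slice q * θ.slice q) := by
        field_simp
      rw [this]
      exact div_pos (hθ'.2 q hq) (mul_self_pos.2 hq)
    simp only [L]
    rw [← Real.log_div (hW0 hθ' hq) hq, Real.exp_log hpos]
    field_simp
  have horb : ∀ θ' : Jet k, θ' ∈ orbit k θ ↔ θ' ∈ signSet θ ∧ F θ' = 0 := by
    intro θ'
    rw [mem_orbit_iff_slice hk h01]
    constructor
    · rintro ⟨hsgn, a, c, ha, hc, hn⟩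
      have hn' : ∀ q : NormalIdx k, θ'.slice q =
          Real.exp (q.weight * Real.log c - q.order * Real.log a) * θ.slice q := fun q => by
        rw [hn q]
        have := exp_weight (Real.log a) (Real.log c) q.1.1.1 q.1.1.2
        rw [Real.exp_log ha, Real.exp_log hc] at this
        rw [this]
        rfl
      have hmem : θ' ∈ signSet θ := by
        refine ⟨hsgn, fun q hq => ?_⟩
        rw [hn' q]
        have := mul_pos (Real.exp_pos (q.weight * Real.log c - q.order * Real.log a))
          (mul_self_pos.2 hq)
        linarith
      refine ⟨hmem, ?_⟩
      have hL : ∀ q, θ.slice q ≠ 0 → L q θ' = q.weight * Real.log c - q.order * Real.log a := by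
        intro q hq
        simp only [L]
        rw [hn' q, Real.log_mul (Real.exp_pos _).ne' hq, Real.log_exp]
        ring
      funext r
      simp only [F, Pi.zero_apply]
      split_ifs with h0
      · rw [hn', h0, mul_zero]
      · rw [hL _ h0, hL s hs, hL t ht]
        linear_combination Real.log c * hPw (e r).1 - Real.log a * hPo (e r).1
    · rintro ⟨hmem, hF⟩
      refine ⟨hmem.1, ?_⟩
      -- The same determinant recovers `log a` and `log c` from the two log-ratios.
      obtain ⟨A, C, hAs, hAt⟩ : ∃ A C : ℝ, L s θ' = s.weight * C - s.order * A ∧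
          L t θ' = t.weight * C - t.order * A :=
        ⟨(t.weight * L s θ' - s.weight * L t θ') / (s.weight * t.order - s.order * t.weight),
          (t.order * L s θ' - s.order * L t θ') / (s.weight * t.order - s.order * t.weight), by
            rw [mul_div_assoc', mul_div_assoc', ← sub_div, eq_div_iff hst]
            ring, by
            rw [mul_div_assoc', mul_div_assoc', ← sub_div, eq_div_iff hst]
            ring⟩
      have hLq : ∀ q, θ.slice q ≠ 0 → L q θ' = q.weight * C - q.order * A := by
        intro q hq
        by_cases hqs : q = s
        · rw [hqs, hAs]
        by_cases hqt : q = t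
        · rw [hqt, hAt]
        have h1 := congrFun hF (e.symm ⟨q, hqs, hqt⟩)
        simp only [F, Equiv.apply_symm_apply, if_neg hq, Pi.zero_apply] at h1
        linear_combination h1 + P q * hAs + Q q * hAt - C * hPw q + A * hPo q
      refine ⟨Real.exp A, Real.exp C, Real.exp_pos _, Real.exp_pos _, fun q => ?_⟩
      rw [exp_weight]
      by_cases hq : θ.slice q = 0
      · rw [hq, mul_zero]
        have hqs : q ≠ s := fun h => hs (h ▸ hq)
        have hqt : q ≠ t := fun h => ht (h ▸ hq)
        have h1 := congrFun hF (e.symm ⟨q, hqs, hqt⟩)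
        simpa only [F, Equiv.apply_symm_apply, if_pos hq, Pi.zero_apply] using h1
      · rw [hLexp hmem hq, hLq q hq]
        rfl
  have hLd : ∀ {θ' : Jet k}, θ' ∈ signSet θ → ∀ {q}, θ.slice q ≠ 0 →
      HasFDerivAt (L q) ((θ'.slice q)⁻¹ • (ContinuousLinearMap.proj q).comp
        (fderiv ℝ (Jet.slice : Jet k → NormalIdx k → ℝ) θ')) θ' := fun hθ' q hq =>
    ((hasFDerivAt_slice_apply (hW1 hθ') q).log (hW0 hθ' hq)).sub_const _
  have hLs : ∀ {θ' : Jet k}, θ' ∈ signSet θ → ∀ {q}, θ.slice q ≠ 0 → ContDiffAt ℝ ∞ (L q) θ' :=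
    fun hθ' q hq => ((contDiffAt_pi.1 (contDiffAt_slice (hW1 hθ')) q).log (hW0 hθ' hq)).sub
      contDiffAt_const
  have hFs : ∀ θ' ∈ signSet θ, ContDiffAt ℝ ∞ F θ' := by
    intro θ' hθ'
    refine contDiffAt_pi.2 fun r => ?_
    simp only [F]
    split_ifs with h0
    · exact contDiffAt_pi.1 (contDiffAt_slice (hW1 hθ')) _
    · exact ((hLs hθ' h0).sub (contDiffAt_const.mul (hLs hθ' hs))).sub
        (contDiffAt_const.mul (hLs hθ' ht))
  intro θ₁ hθ₁
  refine ⟨signSet θ, isOpen_signSet θ, ((horb θ₁).1 hθ₁).1, F,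
    fun θ' hθ' => (hFs θ' hθ').contDiffWithinAt, fun θ' hθ' y => ?_, ?_⟩
  · have hFd := ((hFs θ' hθ').differentiableAt (by simp)).hasFDerivAt
    obtain ⟨v, hv⟩ := exists_forall_apply_eq (surjective_fderiv_slice (hW1 hθ'))
      (e := fun r => (e r).1) (Subtype.val_injective.comp e.injective) (s := s) (t := t)
      (fun r => (e r).2.1) (fun r => (e r).2.2)
      (G := fun r v => fderiv ℝ F θ' v r)
      (m := fun r => if θ.slice (e r).1 = 0 then 1 else (θ'.slice (e r).1)⁻¹)
      (fun r => by
        split_ifs with h0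
        · exact one_ne_zero
        · exact inv_ne_zero (hW0 hθ' h0))
      (fun r v hvs hvt => by
        have h1 := hasFDerivAt_pi'.1 hFd r
        split_ifs with h0
        · simp only [F, if_pos h0] at h1
          have := h1.unique (hasFDerivAt_slice_apply (hW1 hθ') _)
          rw [one_mul]
          exact congrArg (fun M : Jet k →L[ℝ] ℝ => M v) this
        · simp only [F, if_neg h0] at h1
          have := h1.unique (((hLd hθ' h0).sub ((hLd hθ' hs).const_mul (P (e r).1))).sub
            ((hLd hθ' ht).const_mul (Q (e r).1)))
          have h2 := congrArg (fun M : Jet k →L[ℝ] ℝ => M v) this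
          simp only [sub_apply, smul_apply,
            ContinuousLinearMap.comp_apply, ContinuousLinearMap.proj_apply, hvs, hvt,
            smul_eq_mul, mul_zero, sub_zero] at h2
          exact h2) y
    exact ⟨v, funext hv⟩
  · ext θ'
    exact ⟨fun h => ⟨h.2, ((horb θ').1 h.1).2⟩, fun h => ⟨(horb θ').2 h, h.1⟩⟩

/-! ### A basis of Petrov invariants -/

/-- The factor that makes an invariant derivative of bidegree `(i, j)` invariant under scalings. -/
def scaleFactor (i j : ℕ) (p : ℝ × ℝ) : ℝ := p.1 ^ j * p.1⁻¹ * (p.1 * p.2⁻¹) ^ i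

theorem contDiffAt_scaleFactor (i j : ℕ) {p : ℝ × ℝ} (h1 : p.1 ≠ 0) (h2 : p.2 ≠ 0) :
    ContDiffAt ℝ ∞ (scaleFactor i j) p :=
  ((contDiffAt_fst.pow j).mul (contDiffAt_fst.inv h1)).mul
    ((contDiffAt_fst.mul (contDiffAt_snd.inv h2)).pow i)

theorem scaleFactor_ne_zero (i j : ℕ) {p : ℝ × ℝ} (h1 : p.1 ≠ 0) (h2 : p.2 ≠ 0) :
    scaleFactor i j p ≠ 0 :=
  mul_ne_zero (mul_ne_zero (pow_ne_zero _ h1) (inv_ne_zero h1))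
    (pow_ne_zero _ (mul_ne_zero h1 (inv_ne_zero h2)))

/-- Here `z` scales by `c` and `z / z_y` by `a`, so `z^(j-1) (z/z_y)^i` scales by the inverse of the
factor of `w_ij`. -/
theorem scaleFactor_scale (i j : ℕ) {a c z w : ℝ} (ha : a ≠ 0) (hc : c ≠ 0) (hz : z ≠ 0)
    (hw : w ≠ 0) :
    c * c⁻¹ ^ j * a⁻¹ ^ i * scaleFactor i j (c * z, c * a⁻¹ * w) = scaleFactor i j (z, w) := by
  have e : c * z * (c * a⁻¹ * w)⁻¹ = a * (z * w⁻¹) := by field_simp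
  simp only [scaleFactor, e]
  rw [mul_pow c z, mul_pow a, mul_inv, inv_pow, inv_pow]
  have h1 := pow_ne_zero j hc
  have h2 := pow_ne_zero i ha
  field_simp

theorem dense_coord_ne_zero {i j : ℕ} (h : i + j ≤ k) : Dense {θ : Jet k | θ.coord i j ≠ 0} := by
  have hopen : IsOpenMap (fun θ : Jet k => θ.2 ⟨(⟨i, by omega⟩, ⟨j, by omega⟩), h⟩) :=
    (isOpenMap_eval _).comp isOpenMap_snd
  convert (dense_compl_singleton (0 : ℝ)).preimage hopen using 1
  ext θ
  simp [Jet.coord, h]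

theorem isOpen_coord_ne_zero (i j : ℕ) : IsOpen {θ : Jet k | θ.coord i j ≠ 0} :=
  isOpen_ne_fun (contDiff_coord i j).continuous continuous_const

theorem isOpen_generic : IsOpen {θ : Jet k | θ.Generic} :=
  (isOpen_coord_ne_zero 0 0).inter ((isOpen_coord_ne_zero 1 0).inter (isOpen_coord_ne_zero 0 1))

theorem dense_generic (hk : 1 ≤ k) : Dense {θ : Jet k | θ.Generic} :=
  (dense_coord_ne_zero (by omega)).inter_of_isOpen_left
    ((dense_coord_ne_zero (by omega)).inter_of_isOpen_left (dense_coord_ne_zero (by omega))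
      (isOpen_coord_ne_zero 1 0)) (isOpen_coord_ne_zero 0 0)

/-- The invariant of the pseudo-group obtained by scaling an invariant derivative. -/
def scaledSlice (s : NormalIdx k) (θ : Jet k) : ℝ :=
  θ.slice s * scaleFactor s.1.1.1 s.1.1.2 (θ.coord 0 0, θ.coord 1 0)

theorem contDiffAt_scaledSlice (s : NormalIdx k) {θ : Jet k} (hθ : θ.Generic) :
    ContDiffAt ℝ ∞ (scaledSlice s) θ := by
  have h := (contDiffAt_scaleFactor s.1.1.1 s.1.1.2 (p := (θ.coord 0 0, θ.coord 1 0)) hθ.1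
    hθ.2.1).comp θ ((contDiff_coord 0 0).prodMk (contDiff_coord 1 0)).contDiffAt
  exact (contDiffAt_pi.1 (contDiffAt_slice hθ.2.2) s).mul h

theorem scaledSlice_orbit (hk : 1 ≤ k) (s : NormalIdx k) {θ θ' : Jet k} (hθ : θ.Generic)
    (h : θ' ∈ orbit k θ) : scaledSlice s θ' = scaledSlice s θ := by
  obtain ⟨-, a, c, ha, hc, hn⟩ := (mem_orbit_iff hk hθ.2.2).1 h
  have h0 : θ'.coord 0 0 = c * θ.coord 0 0 := by
    simpa [Jet.normal_zero] using hn 0 0 (by omega)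
  have h1 : θ'.coord 1 0 = c * a⁻¹ * θ.coord 1 0 := by
    simpa [Jet.normal_zero] using hn 1 0 (by omega)
  have h2 : θ'.slice s = _ := hn _ _ s.1.2
  rw [scaledSlice, scaledSlice, h0, h1, h2,
    ← scaleFactor_scale s.1.1.1 s.1.1.2 ha.ne' hc.ne' hθ.1 hθ.2.1]
  change _ * θ.normal _ _ * _ = θ.normal _ _ * _
  ring

/-- The scaled invariant derivatives as Petrov invariants. -/
def petrovSlice (hk : 1 ≤ k) (s : NormalIdx k) : PetrovInvariant k where
  dom := {θ | θ.Generic}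
  toFun := scaledSlice s
  isOpen_dom := isOpen_generic
  dense_dom := dense_generic hk
  smooth := fun _ hθ => (contDiffAt_scaledSlice s hθ).contDiffWithinAt
  rational := by
    have hz := RationalOn.coord {θ : Jet k | θ.Generic} 0 0
    have hy := RationalOn.coord {θ : Jet k | θ.Generic} 1 0
    exact (RationalOn.normal (fun θ hθ => hθ.2.2) _ _).mul
      (((hz.pow _).mul (hz.inv fun θ hθ => hθ.1)).mul
        ((hz.mul (hy.inv fun θ hθ => hθ.2.1)).pow _))
  invariant := fun _ hθ _ h _ => scaledSlice_orbit hk s hθ h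

/-- The scale factor depends on `z = w_00` and `z_y = w_10` only, so along directions fixing both it
behaves as a constant. -/
theorem fderiv_scaledSlice (hk : 1 ≤ k) (s : NormalIdx k) {θ : Jet k} (hθ : θ.Generic)
    {v : Jet k} (h0 : fderiv ℝ (Jet.slice : Jet k → NormalIdx k → ℝ) θ v
      (NormalIdx.mk 0 0 (by omega) fun _ => rfl) = 0)
    (h1 : fderiv ℝ (Jet.slice : Jet k → NormalIdx k → ℝ) θ v
      (NormalIdx.mk 1 0 (by omega) fun _ => rfl) = 0) :
    fderiv ℝ (scaledSlice s) θ v = scaleFactor s.1.1.1 s.1.1.2 (θ.coord 0 0, θ.coord 1 0) *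
      fderiv ℝ (Jet.slice : Jet k → NormalIdx k → ℝ) θ v s := by
  have hz := hasFDerivAt_slice_apply hθ.2.2 (NormalIdx.mk 0 0 (by omega) fun _ => rfl)
  have hy := hasFDerivAt_slice_apply hθ.2.2 (NormalIdx.mk 1 0 (by omega) fun _ => rfl)
  simp only [Jet.slice_mk, Jet.normal_zero] at hz hy
  have hμ := ((contDiffAt_scaleFactor s.1.1.1 s.1.1.2 (p := (θ.coord 0 0, θ.coord 1 0)) hθ.1
    hθ.2.1).differentiableAt (by simp)).hasFDerivAt
  have hM := hμ.comp θ (hz.prodMk hy)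
  have hd : HasFDerivAt (scaledSlice s) _ θ := (hasFDerivAt_slice_apply hθ.2.2 s).mul hM
  rw [hd.fderiv]
  simp only [add_apply, smul_apply, ContinuousLinearMap.comp_apply,
    ContinuousLinearMap.prod_apply, ContinuousLinearMap.proj_apply, h0, h1, smul_eq_mul]
  rw [Prod.mk_zero_zero, map_zero, mul_zero, zero_add]

/-! ### Sign chambers, local bases and their size -/

/-- The jets with the same signs of `z`, `z_y` and `z_u` as `θ`. -/
def chamber (θ : Jet k) : Set (Jet k) :=
  {θ' | 0 < θ.coord 0 0 * θ'.coord 0 0} ∩ ({θ' | 0 < θ.coord 1 0 * θ'.coord 1 0} ∩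
    {θ' | 0 < θ.coord 0 1 * θ'.coord 0 1})

theorem chamber_generic {θ θ' : Jet k} (h : θ' ∈ chamber θ) : θ'.Generic :=
  ⟨right_ne_zero_of_mul (ne_of_gt h.1), right_ne_zero_of_mul (ne_of_gt h.2.1),
    right_ne_zero_of_mul (ne_of_gt h.2.2)⟩

theorem mem_chamber_self {θ : Jet k} (h : θ.Generic) : θ ∈ chamber θ :=
  ⟨mul_self_pos.2 h.1, mul_self_pos.2 h.2.1, mul_self_pos.2 h.2.2⟩

theorem isOpen_chamber (θ : Jet k) : IsOpen (chamber θ) := by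
  have h : ∀ i j, IsOpen {θ' : Jet k | 0 < θ.coord i j * θ'.coord i j} := fun i j =>
    isOpen_lt continuous_const (continuous_const.mul (contDiff_coord i j).continuous)
  exact (h 0 0).inter ((h 1 0).inter (h 0 1))

theorem convex_chamber (θ : Jet k) : Convex ℝ (chamber θ) := by
  have h : ∀ i j, Convex ℝ {θ' : Jet k | 0 < θ.coord i j * θ'.coord i j} := fun i j => by
    refine convex_halfSpace_gt ⟨fun x y => ?_, fun c x => ?_⟩ 0
    · unfold Jet.coord
      split_ifs
      · simp only [Prod.snd_add, Pi.add_apply, mul_add]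
      · simp
    · unfold Jet.coord
      split_ifs
      · simp only [Prod.smul_snd, Pi.smul_apply, smul_eq_mul]
        ring
      · simp
  exact (h 0 0).inter ((h 1 0).inter (h 0 1))

theorem mul_pos_of_mul_pos {x y z : ℝ} (h : 0 < x * y) (h' : 0 < x * z) : 0 < y * z := by
  have h1 := mul_pos h h'
  have h2 : 0 < x * x := mul_self_pos.2 (left_ne_zero_of_mul h.ne')
  exact (mul_pos_iff_of_pos_left h2).1 (by linarith : 0 < x * x * (y * z))

theorem div_pos_of_mul_pos {x y : ℝ} (h : 0 < x * y) : 0 < y / x := by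
  have hx := left_ne_zero_of_mul h.ne'
  have : y / x = x * y / (x * x) := by field_simp
  rw [this]
  exact div_pos h (mul_self_pos.2 hx)

/-- In a chamber the scaled invariant derivatives separate the orbits. -/
theorem mem_orbit_of_scaledSlice_eq (hk : 1 ≤ k) {θ₀ θ θ' : Jet k} (hθ : θ ∈ chamber θ₀)
    (hθ' : θ' ∈ chamber θ₀)
    (h : ∀ s : NormalIdx k, s ≠ NormalIdx.mk 0 0 (by omega) (fun _ => rfl) →
      s ≠ NormalIdx.mk 1 0 (by omega) (fun _ => rfl) → scaledSlice s θ' = scaledSlice s θ) :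
    θ' ∈ orbit k θ := by
  have hg := chamber_generic hθ
  have hg' := chamber_generic hθ'
  refine (mem_orbit_iff_slice hk hg.2.2).2 ⟨mul_pos_of_mul_pos hθ.2.2 hθ'.2.2, ?_⟩
  have hc : 0 < θ'.coord 0 0 / θ.coord 0 0 := div_pos_of_mul_pos (mul_pos_of_mul_pos hθ.1 hθ'.1)
  have hy : 0 < θ'.coord 1 0 / θ.coord 1 0 :=
    div_pos_of_mul_pos (mul_pos_of_mul_pos hθ.2.1 hθ'.2.1)
  obtain ⟨c, hcdef⟩ : ∃ c, c = θ'.coord 0 0 / θ.coord 0 0 := ⟨_, rfl⟩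
  obtain ⟨d, hddef⟩ : ∃ d, d = θ'.coord 1 0 / θ.coord 1 0 := ⟨_, rfl⟩
  rw [← hcdef] at hc
  rw [← hddef] at hy
  -- The ratio of the values of `z` is `c`, and that of `z_y` is `d = c / a`; equal signs in the
  -- chamber make both positive.
  have ha : 0 < c / d := div_pos hc hy
  have hz' : θ'.coord 0 0 = c * θ.coord 0 0 := by
    rw [hcdef, div_mul_cancel₀ _ hg.1]
  have hy' : θ'.coord 1 0 = c * (c / d)⁻¹ * θ.coord 1 0 := by
    have : c * (c / d)⁻¹ = d := by field_simp
    rw [this, hddef, div_mul_cancel₀ _ hg.2.1]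
  refine ⟨c / d, c, ha, hc, fun s => ?_⟩
  by_cases h0 : s = NormalIdx.mk 0 0 (by omega) (fun _ => rfl)
  · subst h0
    rw [Jet.slice_mk, Jet.slice_mk, Jet.normal_zero, Jet.normal_zero, hz']
    simp [NormalIdx.mk]
  by_cases h1 : s = NormalIdx.mk 1 0 (by omega) (fun _ => rfl)
  · subst h1
    rw [Jet.slice_mk, Jet.slice_mk, Jet.normal_zero, Jet.normal_zero, hy']
    simp [NormalIdx.mk]
  have h2 := h s h0 h1
  rw [scaledSlice, scaledSlice,
    ← scaleFactor_scale s.1.1.1 s.1.1.2 ha.ne' hc.ne' hg.1 hg.2.1, ← hz', ← hy'] at h2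
  refine mul_right_cancel₀ (scaleFactor_ne_zero s.1.1.1 s.1.1.2
    (p := (θ'.coord 0 0, θ'.coord 1 0)) hg'.1 hg'.2.1) ?_
  rw [h2]
  ring

theorem isLocalBasis_chamber (hk : 1 ≤ k) {ν : ℕ} (hν : ν + k + 2 = (k + 2).choose 2)
    (θ₀ : Jet k) : ∃ J : Fin ν → PetrovInvariant k, IsLocalBasis (chamber θ₀) J := by
  have hne : (NormalIdx.mk 0 0 (by omega) (fun _ => rfl) : NormalIdx k) ≠
      NormalIdx.mk 1 0 (by omega) (fun _ => rfl) := by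
    simp [NormalIdx.mk]
  obtain ⟨e⟩ := exists_index_equiv hν hne
  refine ⟨fun r => petrovSlice hk (e r).1, fun r θ hθ => chamber_generic hθ, fun θ hθ => ?_,
    fun I => ?_⟩
  · have hg := chamber_generic hθ
    refine linearIndependent_of_surjective fun y => ?_
    exact exists_forall_apply_eq (surjective_fderiv_slice hg.2.2)
      (e := fun r => (e r).1) (Subtype.val_injective.comp e.injective)
      (fun r => (e r).2.1) (fun r => (e r).2.2)
      (G := fun r v => fderiv ℝ (scaledSlice (e r).1) θ v)
      (fun r => scaleFactor_ne_zero _ _ hg.1 hg.2.1)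
      (fun r v h0 h1 => fderiv_scaledSlice hk _ hg h0 h1) y
  · classical
    -- The value at `y` is that of `I` at any jet of the chamber and of `I.dom` with these
    -- invariants; separation of orbits makes the choice immaterial. Outside the image the value `0`
    -- is arbitrary.
    refine ⟨fun y => if h : ∃ θ, θ ∈ chamber θ₀ ∩ I.dom ∧
      (fun r => scaledSlice (e r).1 θ) = y then I.toFun h.choose else 0, fun θ hθ => ?_⟩
    have hex : ∃ θ', θ' ∈ chamber θ₀ ∩ I.dom ∧ (fun r => scaledSlice (e r).1 θ') =
        fun r => scaledSlice (e r).1 θ := ⟨θ, hθ, rfl⟩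
    refine Eq.trans ?_ (dif_pos hex).symm
    obtain ⟨h1, h2⟩ := hex.choose_spec
    refine I.invariant _ h1.2 _ (mem_orbit_of_scaledSlice_eq hk h1.1 hθ.1 fun s hs0 hs1 => ?_) hθ.2
    have := congrFun h2 (e.symm ⟨s, hs0, hs1⟩)
    simp only [Equiv.apply_symm_apply] at this
    exact this.symm

theorem IsLocalBasis.card_le {n m : ℕ} {D D' : Set (Jet k)} {J : Fin n → PetrovInvariant k}
    {K : Fin m → PetrovInvariant k} (hJ : IsLocalBasis D J) (hK : IsLocalBasis D' K)
    (hD : IsOpen D) {θ : Jet k} (hθ : θ ∈ D) (hθ' : θ ∈ D') : m ≤ n := by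
  refine card_le_of_factors (fun i => (J i).smooth.contDiffAt ((J i).isOpen_dom.mem_nhds
    (hJ.1 i hθ))) (fun i => (K i).smooth.contDiffAt ((K i).isOpen_dom.mem_nhds (hK.1 i hθ')))
    (hJ.2.1 θ hθ) (hK.2.1 θ hθ') fun i => ?_
  obtain ⟨F, hF⟩ := hJ.2.2 (K i)
  refine ⟨F, ?_⟩
  filter_upwards [hD.mem_nhds hθ, (K i).isOpen_dom.mem_nhds (hK.1 i hθ')] with t h1 h2
  exact hF t ⟨h1, h2⟩

/-- The group multiplies each of `z`, `z_y`, `z_u` by a positive factor, so genericity is constant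
on orbits. -/
theorem Jet.Generic.isRegularOrbit (hk : 1 ≤ k) {θ : Jet k} (hθ : θ.Generic) :
    IsRegularOrbit k (orbit k θ) := by
  refine ⟨⟨θ, rfl⟩, ?_⟩
  rintro _ ⟨φ, hu, rfl⟩
  refine (isRegular_iff hk _).2 (Jet.Generic.injective ⟨?_, ?_, ?_⟩ hk)
  · rw [φ.coord_prolong_zero θ hu (Nat.zero_le k)]
    exact mul_ne_zero (mul_ne_zero φ.c_pos.ne' (pow_ne_zero _ (inv_ne_zero φ.a_pos.ne'))) hθ.1
  · rw [φ.coord_prolong_zero θ hu hk]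
    exact mul_ne_zero (mul_ne_zero φ.c_pos.ne' (pow_ne_zero _ (inv_ne_zero φ.a_pos.ne'))) hθ.2.1
  · rw [φ.coord_prolong_zero_one θ hu hk]
    exact mul_ne_zero (mul_ne_zero φ.c_pos.ne' (inv_ne_zero (φ.deriv_pos _ hu).ne')) hθ.2.2

theorem mem_orbit_self (θ : Jet k) : θ ∈ orbit k θ := by
  let φ : Feedback := ⟨1, 0, 1, OpenPartialHomeomorph.refl ℝ, one_pos, one_pos,
    contDiff_id.contDiffOn, fun u _ => by simp⟩
  refine ⟨φ, Set.mem_univ _, Prod.ext (Prod.ext ?_ rfl) (funext fun σ => ?_)⟩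
  · change 1 * θ.1.1 + 0 = θ.1.1
    ring
  · rw [← Jet.coord_idx, ← Jet.coord_idx, φ.coord_prolong θ (Set.mem_univ _) σ.2,
      ← θ.iteratedDeriv_rowFun σ.1.1 σ.1.2]
    simp [φ]

theorem exists_codim (hk : 1 ≤ k) : ∃ ν : ℕ, ν + k + 2 = (k + 2).choose 2 ∧
    (ν : ℚ) = ((k : ℚ) ^ 2 + (k : ℚ) - 2) / 2 := by
  have hq := Nat.cast_choose_two ℚ (k + 2)
  push_cast at hq
  have hle : k + 2 ≤ (k + 2).choose 2 := by
    have h1 : (1 : ℚ) ≤ k := by exact_mod_cast hk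
    have : ((k + 2 : ℕ) : ℚ) ≤ ((k + 2).choose 2 : ℕ) := by
      rw [hq]
      push_cast
      nlinarith
    exact_mod_cast this
  refine ⟨(k + 2).choose 2 - (k + 2), by omega, ?_⟩
  rw [Nat.cast_sub hle, hq]
  push_cast
  ring

end QHOE

end

/-! ### Assembly of the theorem -/

theorem mainTheorem3 (k : ℕ) (hk : 1 ≤ k) :
    ∃ ν : ℕ, (ν : ℚ) = ((k : ℚ) ^ 2 + (k : ℚ) - 2) / 2 ∧
      -- every local basis has exactly `ν` elements
      (∀ D : Set (QHOE.Jet k), IsOpen D → D.Nonempty →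
        ∀ (n : ℕ) (J : Fin n → QHOE.PetrovInvariant k), QHOE.IsLocalBasis D J → n = ν) ∧
      -- local bases exist near generic points
      Dense {θ : QHOE.Jet k | ∃ D : Set (QHOE.Jet k), IsOpen D ∧ IsConnected D ∧ θ ∈ D ∧
        ∃ J : Fin ν → QHOE.PetrovInvariant k, QHOE.IsLocalBasis D J} ∧
      -- regular orbits fill a dense set and have codimension `ν`
      Dense {θ : QHOE.Jet k | QHOE.IsRegularOrbit k (QHOE.orbit k θ)} ∧
      (∀ O : Set (QHOE.Jet k), QHOE.IsRegularOrbit k O → QHOE.IsSubmanifoldOfCodim O ν) ∧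
      (∀ θ : QHOE.Jet k, QHOE.IsRegular k θ →
        Module.finrank ℝ (QHOE.tangentSpan k θ) + ν = Module.finrank ℝ (QHOE.Jet k)) ∧
      -- dimension of the fibre, and rank of the stationary subalgebra on it
      Module.finrank ℝ (QHOE.vertical k) = (k + 2).choose 2 ∧
      (∀ θ : QHOE.Jet k, QHOE.IsRegular k θ →
        QHOE.stabilizerSpan k θ ≤ QHOE.vertical k ∧
        Module.finrank ℝ (QHOE.stabilizerSpan k θ) = k + 2) := by
  obtain ⟨ν, hν, hνq⟩ := QHOE.exists_codim hk
  refine ⟨ν, hνq, fun D hD hDne n J hJ => ?_, (QHOE.dense_generic hk).mono fun θ hθ => ?_,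
    (QHOE.dense_generic hk).mono fun θ hθ => hθ.isRegularOrbit hk, ?_, fun θ hθ => ?_,
    QHOE.finrank_vertical k, fun θ hθ => ⟨QHOE.stabilizerSpan_le_vertical θ,
      QHOE.finrank_stabilizerSpan ((QHOE.isRegular_iff hk θ).1 hθ)⟩⟩
  -- At a generic point of `D` the given basis is compared, in both directions, with the explicit
  -- one of the chamber.
  · obtain ⟨θ, hθD, hθ⟩ := (QHOE.dense_generic hk).inter_open_nonempty D hD hDne
    obtain ⟨K, hK⟩ := QHOE.isLocalBasis_chamber hk hν θ
    have hθc := QHOE.mem_chamber_self hθ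
    exact le_antisymm (hK.card_le hJ (QHOE.isOpen_chamber θ) hθc hθD)
      (hJ.card_le hK hD hθD hθc)
  · exact ⟨QHOE.chamber θ, QHOE.isOpen_chamber θ,
      (QHOE.convex_chamber θ).isConnected ⟨θ, QHOE.mem_chamber_self hθ⟩,
      QHOE.mem_chamber_self hθ, QHOE.isLocalBasis_chamber hk hν θ⟩
  · rintro O ⟨⟨θ, rfl⟩, hO⟩
    exact QHOE.isSubmanifoldOfCodim_orbit hk hν
      ((QHOE.isRegular_iff hk θ).1 (hO θ (QHOE.mem_orbit_self θ)))
  · have h1 := QHOE.finrank_tangentSpan ((QHOE.isRegular_iff hk θ).1 hθ)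
    rw [h1, QHOE.finrank_jet]
    omega
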